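/- Call a triangle's angles incommensurable if they are not all rational multiples of $\pi$. A tiling of a triangle $T$ into $N$ tiles is a decomposition of $T$ into $N$ triangles, all congruent to one triangle $R$ (the tile), that overlap only at their boundaries; it is called non-square if $N$ is not a perfect square. Let $T$ be a triangle with incommensurable angles $(A,B,\pi/3)$ and suppose that $\sqrt3\,\tan(A/2)\in\mathbb{Q}$. Then $T$ has a non-square tiling. More precisely, put $\alpha=\min(A,B)$ and $\beta=\max(A,B)-\pi/3$. There are positive integers $a,b,c$ with $\gcd(a,b)=1$ and $c^2=a^2+ab+b^2$ such that, for every sufficiently large integer $m$, the triangle $T$ can be tiled by $m^2\,b(a+b)$ congruent triangles with angles $(\alpha,\beta,2\pi/3)$ whose sides opposite these angles are in the ratio $a:b:c$; and the number $m^2\,b(a+b)$ is not a perfect square. -/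

import Mathlib

/-- The Euclidean plane. -/
abbrev Plane : Type := EuclideanSpace ℝ (Fin 2)

/-- A nondegenerate triangle in the plane, given by its three (affinely independent) vertices. -/
abbrev Tri : Type := Affine.Triangle ℝ Plane

namespace Tri

/-- The angle of the triangle at the vertex with index `i` (indices are taken modulo 3). -/
noncomputable def angleAt (T : Tri) (i : Fin 3) : ℝ :=
  EuclideanGeometry.angle (T.points (i + 1)) (T.points i) (T.points (i + 2))

/-- The length of the side opposite to the vertex with index `i`. -/
noncomputable def side (T : Tri) (i : Fin 3) : ℝ :=
  dist (T.points (i + 1)) (T.points (i + 2))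

/-- The closed triangular region spanned by the vertices. -/
def region (T : Tri) : Set Plane := convexHull ℝ (Set.range T.points)

/-- A triangle has commensurable angles if all its angles are rational multiples of `π`. -/
def CommensurableAngles (T : Tri) : Prop :=
  ∀ i : Fin 3, ∃ q : ℚ, T.angleAt i = (q : ℝ) * Real.pi

/-- A triangle has incommensurable angles if its angles are not all rational multiples of `π`. -/
def IncommensurableAngles (T : Tri) : Prop := ¬ T.CommensurableAngles

/-- `T` can be cut into `N` triangles congruent to the tile `R` (reflections allowed) that overlap
only at their boundaries. Since a piece may list its vertices in any order, it is no loss of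
generality that the congruence respects the order of the vertices. -/
def TilesInto (T R : Tri) (N : ℕ) : Prop :=
  ∃ P : Fin N → Tri,
    (∀ i, Congruent (P i).points R.points) ∧
    (⋃ i, (P i).region) = T.region ∧
    (∀ i j, i ≠ j → Disjoint (interior (P i).region) (interior (P j).region))

/-- `T` can be tiled by a non-square number of congruent triangles. -/
def HasNonSquareTiling (T : Tri) : Prop :=
  ∃ (R : Tri) (N : ℕ), T.TilesInto R N ∧ ¬ IsSquare N

end Tri

/-!
# Non-square tilings of triangles with an angle `π/3`

Write `T` for the triangle, `C` for its vertex with angle `π/3`, and `V`, `W` for the vertices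
with the smaller and the larger of the remaining angles. By the law of sines, rationality of
`√3 tan (A / 2)` makes the sides of `T` commensurable (`Tri.exists_nat_sides`), and the law of
cosines then provides coprime `a`, `b` with `c² = a² + a b + b²` and `CV : CW = a + b : a`
(`exists_coprime_params`). In suitable units `CV = m b (a + b)` and `CW = m a b`, and the tile is
the triangle with sides `a`, `b`, `c`, in which `a` and `b` enclose the angle `2π/3`.

Everything is computed in coordinates along the two sides at `C`, where squared lengths are given
by `x² + x y + y²` (`normForm`). The segment from `W` to the point of `CV` at distance `m a b`
from `C` cuts `T` into an equilateral triangle of side `m a b` and the tile enlarged by the factor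
`m b`, which is a union of `(m b)²` tiles (`dissect_triangle`). It remains to tile the equilateral
triangle.

The key observation is `dissect_trapezoid_base`: the tiles enlarged by `a`, `b` and `c` fit
together to an isosceles trapezoid with legs `a b` and parallel sides `a² + b²` and
`c² = a² + a b + b²`. Parallelograms with sides `a` and `b` consist of two tiles; attaching them to
the trapezoid gives trapezoids with legs `a b` and shorter base `j a b` for all large `j`
(`dissect_trapezoid_layer`), and stacking such layers gives legs `n a b` for all `n ≥ 1`
(`dissect_trapezoid_stack`). An equilateral triangle is a union of three isosceles trapezoids in
cyclic position (`dissect_equilateral`), whence the tiling for all large `m`.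

Finally, `b (a + b)` is not a square: otherwise `b = s²`, `a + b = t²` and `t⁴ - t² s² + s⁴ = c²`,
an equation which has only trivial solutions by infinite descent (`eq_of_quartic_eq_sq`).
-/

/-! ### The equation `x⁴ - x²y² + y⁴ = z²` -/

/-- The descent step for `x⁴ - x²y² + y⁴ = z²` with `x` odd and `y` even: a parametrization
`x² - y² = p² - q²`, `x y = 2 p q` of the Pythagorean triple `(x² - y², x y, z)` yields another
nontrivial solution `(M, N, s)` with `s ∣ x`. Writing `x = r s`, `y = 2 u v`, `p = r u`, `q = s v`,
one finds `u² = v² + r²` and `s² = 4 v² + r²`; the first equation is again a Pythagorean triple, and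
its parameters turn the second into the quartic. -/
theorem exists_smaller_of_odd_even {x y p q : ℤ} (hxy : IsCoprime x y) (hpq : IsCoprime p q)
    (hx : Odd x) (hx0 : x ≠ 0) (hy0 : y ≠ 0) (h1 : x ^ 2 - y ^ 2 = p ^ 2 - q ^ 2)
    (h2 : x * y = 2 * p * q) (hpar : (p % 2 = 0 ∧ q % 2 = 1) ∨ (p % 2 = 1 ∧ q % 2 = 0)) :
    ∃ M N s : ℤ, IsCoprime M N ∧ M ≠ 0 ∧ N ≠ 0 ∧ M ^ 2 ≠ N ^ 2 ∧ s ∣ x ∧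
      M ^ 4 - M ^ 2 * N ^ 2 + N ^ 4 = s ^ 2 := by
  have hye : Even y := by
    have : Even (x * y) := ⟨p * q, by rw [h2]; ring⟩
    rcases Int.even_mul.1 this with h | h
    · exact absurd h (Int.not_even_iff_odd.2 hx)
    · exact h
  obtain ⟨x', hx'⟩ := hx
  obtain ⟨y', hy'⟩ := hye
  have hp : p % 2 = 1 ∧ q % 2 = 0 := by
    rcases hpar with ⟨hp, hq⟩ | h
    · exfalso
      obtain ⟨p', rfl⟩ : ∃ k, p = 2 * k := ⟨p / 2, by omega⟩
      obtain ⟨q', rfl⟩ : ∃ k, q = 2 * k + 1 := ⟨q / 2, by omega⟩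
      subst hx' hy'
      ring_nf at h1
      omega
    · exact h
  have hpo : Odd p := Int.odd_iff.2 hp.1
  have hqe : Even q := Int.even_iff.2 hp.2
  have hq0 : q ≠ 0 := by
    rintro rfl
    simp at h2
    tauto
  -- split `x y = 2 p q` into coprime factors: `x = r s`, `p = r u`, `q = s v`, `y = 2 u v`
  obtain ⟨r, s, u, hg, hxr, hpr, hsu⟩ :
      ∃ r s u : ℤ, r ≠ 0 ∧ x = r * s ∧ p = r * u ∧ IsCoprime s u := by
    have hg : (Int.gcd x p : ℤ) ≠ 0 := by
      simp [Int.gcd_eq_zero_iff, hx0]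
    obtain ⟨s, hs⟩ := Int.gcd_dvd_left x p
    obtain ⟨u, hu⟩ := Int.gcd_dvd_right x p
    refine ⟨Int.gcd x p, s, u, hg, hs, hu, ?_⟩
    have := Int.gcd_eq_gcd_ab x p
    refine ⟨Int.gcdA x p, Int.gcdB x p, mul_left_cancel₀ hg ?_⟩
    linear_combination (-1 : ℤ) * this - Int.gcdA x p * hs - Int.gcdB x p * hu
  have hso : Odd s := by
    have : Odd (r * s) := by rw [← hxr, hx']; exact ⟨x', rfl⟩
    exact (Int.odd_mul.1 this).2
  have huo : Odd u := (Int.odd_mul.1 (hpr ▸ hpo)).2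
  have hro : Odd r := (Int.odd_mul.1 (hpr ▸ hpo)).1
  have h3 : s * y = 2 * u * q := by
    apply mul_left_cancel₀ hg
    rw [hxr, hpr] at h2
    linear_combination h2
  obtain ⟨v, hv⟩ : s ∣ q := by
    have h4 : s ∣ u * (2 * q) := ⟨y, by linear_combination -h3⟩
    have h5 : s ∣ 2 * q := hsu.dvd_of_dvd_mul_left h4
    have h6 : IsCoprime s 2 := by
      obtain ⟨t, ht⟩ := hso
      exact ⟨1, -t, by rw [ht]; ring⟩
    exact h6.dvd_of_dvd_mul_left h5
  have hs0 : s ≠ 0 := by rintro rfl; simp at hso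
  have hyv : y = 2 * u * v := by
    apply mul_left_cancel₀ hs0
    rw [h3, hv]; ring
  have hve : Even v := by
    rw [hv] at hqe
    rcases Int.even_mul.1 hqe with h | h
    · exact absurd h (Int.not_even_iff_odd.2 hso)
    · exact h
  have hv0 : v ≠ 0 := by rintro rfl; simp at hv; exact hq0 hv
  have hrv : IsCoprime r v := by
    have : IsCoprime (r * s) (2 * u * v) := by rw [← hxr, ← hyv]; exact hxy
    exact this.of_mul_left_left.of_mul_right_right
  have h7 : r ^ 2 * (s ^ 2 - u ^ 2) = v ^ 2 * (4 * u ^ 2 - s ^ 2) := by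
    rw [hxr, hyv, hpr, hv] at h1
    linear_combination h1
  obtain ⟨k, hk⟩ : v ^ 2 ∣ s ^ 2 - u ^ 2 :=
    (hrv.symm.pow (m := 2) (n := 2)).dvd_of_dvd_mul_left ⟨_, h7⟩
  have hk' : 4 * u ^ 2 - s ^ 2 = r ^ 2 * k := by
    apply mul_left_cancel₀ (pow_ne_zero 2 hv0)
    rw [← h7, hk]; ring
  have hk3 : k ∣ 3 := by
    obtain ⟨e, f, hef⟩ := hsu.pow (m := 2) (n := 2)
    refine ⟨e * (4 * v ^ 2 + r ^ 2) + f * (v ^ 2 + r ^ 2), ?_⟩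
    linear_combination (-3) * hef + e * (4 * hk + hk') + f * (hk + hk')
  -- `k ∣ 3`; modulo 4, `k` is `3` or `-1`, and the signs of the two quadratic forms exclude `-1`
  have hk8 : k = 3 := by
    have hle : k ≤ 3 := Int.le_of_dvd (by norm_num) hk3
    have hge : -3 ≤ k := by
      have := Int.le_of_dvd (by norm_num) ((neg_dvd (a := k)).2 hk3)
      omega
    have hr8 := Int.sq_mod_four_eq_one_of_odd hro
    have hu8 := Int.sq_mod_four_eq_one_of_odd huo
    have hs8 := Int.sq_mod_four_eq_one_of_odd hso
    have hk1 : (r ^ 2 * k) % 4 = k % 4 := by rw [Int.mul_emod, hr8]; simp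
    have hk4 : k % 4 = 3 := by omega
    have : k = 3 ∨ k = -1 := by omega
    rcases this with h | h
    · exact h
    · exfalso
      subst h
      have hlt : s ^ 2 > 4 * u ^ 2 := by nlinarith [sq_nonneg r, sq_pos_of_ne_zero hg]
      nlinarith [sq_nonneg v, sq_nonneg u]
  subst hk8
  have hur : u ^ 2 = v ^ 2 + r ^ 2 := by linarith
  have hsr : s ^ 2 = 4 * v ^ 2 + r ^ 2 := by linarith
  have hpy : PythagoreanTriple r v u := by unfold PythagoreanTriple; linarith
  obtain ⟨m, n, hmn, -, hcop, hpar'⟩ :=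
    PythagoreanTriple.coprime_classification.1 ⟨hpy, Int.isCoprime_iff_gcd_eq_one.1 hrv⟩
  rcases hmn with ⟨hr, hv'⟩ | ⟨hr, -⟩
  · have hmn0 : m * n ≠ 0 := by
      intro h; apply hv0; rw [hv', mul_assoc, h, mul_zero]
    have hMN : (m + n) * (m - n) ≠ 0 := by
      intro h; apply hg; rw [hr]; linear_combination h
    refine ⟨m + n, m - n, s, ?_, left_ne_zero_of_mul hMN, right_ne_zero_of_mul hMN, ?_,
      ⟨r, by rw [hxr]; ring⟩, ?_⟩
    · have hodd : Odd (m + n) := by rw [Int.odd_iff]; omega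
      obtain ⟨t, ht⟩ := hodd
      have hc : IsCoprime m n := Int.isCoprime_iff_gcd_eq_one.2 hcop
      have h1 : IsCoprime (m + n) n := by
        have := hc.add_mul_left_left 1
        rwa [mul_one] at this
      have h2 : IsCoprime (m + n) 2 := ⟨1, -t, by rw [ht]; ring⟩
      have h3 : IsCoprime (m + n) (-(2 * n)) := (h2.mul_right h1).neg_right
      rw [show m - n = -(2 * n) + (m + n) * 1 by ring]
      exact h3.add_mul_left_right 1
    · intro h
      apply hmn0
      linarith [show (m + n) ^ 2 - (m - n) ^ 2 = 4 * (m * n) by ring]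
    · rw [hsr, hv', hr]; ring
  · exfalso
    rw [hr] at hro
    have : Even (2 * m * n) := ⟨m * n, by ring⟩
    exact (Int.not_even_iff_odd.2 hro) this

/-- Coprime nonzero solutions of `x⁴ - x²y² + y⁴ = z²` are trivial, by infinite descent on `|z|`. -/
theorem eq_of_quartic_eq_sq (k : ℕ) : ∀ x y z : ℤ, z.natAbs = k → IsCoprime x y → x ≠ 0 → y ≠ 0 →
    x ^ 4 - x ^ 2 * y ^ 2 + y ^ 4 = z ^ 2 → x ^ 2 = y ^ 2 := by
  induction k using Nat.strong_induction_on with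
  | _ k ih =>
  intro x y z hz hxy hx hy h
  by_contra hne
  -- by minimality, every nontrivial solution `(M, N, s)` has `|z| ≤ |s|`
  have hlt : ∀ M N s : ℤ, IsCoprime M N → M ≠ 0 → N ≠ 0 → M ^ 2 ≠ N ^ 2 →
      M ^ 4 - M ^ 2 * N ^ 2 + N ^ 4 = s ^ 2 → z ^ 2 ≤ s ^ 2 := by
    intro M N s hc hM hN hMN hs
    by_contra hlt
    exact hMN (ih s.natAbs (by rw [← hz]; exact Int.natAbs_lt_iff_sq_lt.2 (not_le.1 hlt)) M N s rfl
      hc hM hN hs)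
  have hd : 0 < (x ^ 2 - y ^ 2) ^ 2 := by
    have : x ^ 2 - y ^ 2 ≠ 0 := sub_ne_zero.2 hne
    positivity
  have hz2 : x ^ 2 * y ^ 2 < z ^ 2 := by nlinarith
  have key : ∀ x y p q : ℤ, IsCoprime x y → IsCoprime p q → Odd x → x ≠ 0 → y ≠ 0 →
      x ^ 2 - y ^ 2 = p ^ 2 - q ^ 2 → x * y = 2 * p * q →
      ((p % 2 = 0 ∧ q % 2 = 1) ∨ (p % 2 = 1 ∧ q % 2 = 0)) → x ^ 2 * y ^ 2 < z ^ 2 → False := by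
    intro x y p q hxy hpq ho hx hy h1 h2 hpar hz2
    obtain ⟨M, N, s, hc, hM, hN, hMN, hsx, hs⟩ :=
      exists_smaller_of_odd_even hxy hpq ho hx hy h1 h2 hpar
    have h3 := hlt M N s hc hM hN hMN hs
    have h4 : s ^ 2 ≤ x ^ 2 := Int.le_of_dvd (by positivity) (pow_dvd_pow_of_dvd hsx 2)
    have h5 : 1 ≤ y ^ 2 := Int.add_one_le_iff.2 (sq_pos_of_ne_zero hy)
    nlinarith [sq_nonneg x]
  have hpy : PythagoreanTriple (x ^ 2 - y ^ 2) (x * y) z := by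
    unfold PythagoreanTriple; linear_combination h
  have hcop : IsCoprime (x ^ 2 - y ^ 2) (x * y) := by
    have h1 : IsCoprime (x ^ 2 - y ^ 2) x := by
      have h2 : IsCoprime (-y ^ 2) x := (hxy.symm.pow_left (m := 2)).neg_left
      rw [show x ^ 2 - y ^ 2 = -y ^ 2 + x * x by ring]
      exact h2.add_mul_left_left x
    have h1' : IsCoprime (x ^ 2 - y ^ 2) y := by
      have h2 : IsCoprime (x ^ 2) y := (hxy.pow_left (m := 2))
      rw [show x ^ 2 - y ^ 2 = x ^ 2 + y * -y by ring]
      exact h2.add_mul_left_left (-y)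
    exact h1.mul_right h1'
  obtain ⟨p, q, hmn, -, hc, hpar⟩ :=
    PythagoreanTriple.coprime_classification.1 ⟨hpy, Int.isCoprime_iff_gcd_eq_one.1 hcop⟩
  have hc' : IsCoprime p q := Int.isCoprime_iff_gcd_eq_one.2 hc
  rcases hmn with ⟨h1, h2⟩ | ⟨h1, h2⟩
  · by_cases ho : Odd x
    · exact key x y p q hxy hc' ho hx hy h1 h2 hpar hz2
    · have hyo : Odd y := by
        by_contra hy'
        rw [Int.not_odd_iff_even] at ho hy'
        have := hxy.isUnit_of_dvd' ho.two_dvd hy'.two_dvd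
        exact absurd this (by decide)
      exact key y x q p hxy.symm hc'.symm hyo hy hx (by linarith) (by linarith) (by tauto)
        (by linarith)
  · -- both `x` and `y` are odd, and `(p, q)` is a smaller solution
    have hpq : p * q ≠ 0 := by
      intro h0; apply hne; linear_combination h1 + 2 * h0
    have hev : Even (x ^ 2 + y ^ 2) := by
      have : x ^ 2 + y ^ 2 = 2 * (p * q + y ^ 2) := by linear_combination h1
      rw [this]; exact even_two_mul _
    obtain ⟨w, hw⟩ := hev
    have hw2 : p ^ 4 - p ^ 2 * q ^ 2 + q ^ 4 = w ^ 2 := by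
      have : 4 * (p ^ 4 - p ^ 2 * q ^ 2 + q ^ 4) = 4 * w ^ 2 := by
        have e1 : (x ^ 2 + y ^ 2) ^ 2 = (w + w) ^ 2 := by rw [hw]
        have e2 : (x ^ 2 - y ^ 2) ^ 2 = (2 * p * q) ^ 2 := by rw [h1]
        have e3 : (x * y) ^ 2 = (p ^ 2 - q ^ 2) ^ 2 := by rw [h2]
        linear_combination e1 - e2 - 4 * e3
      linarith
    have := hlt p q w hc' (left_ne_zero_of_mul hpq) (right_ne_zero_of_mul hpq) (by
      intro h0
      have : x * y = 0 := by rw [h2, h0]; ring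
      rcases mul_eq_zero.1 this with h | h
      · exact hx h
      · exact hy h) hw2
    have e1 : (x ^ 2 + y ^ 2) ^ 2 = (w + w) ^ 2 := by rw [hw]
    nlinarith

/-- If `b (a + b)` is a square, then so are the coprime factors `b = s²` and `a + b = t²`, and
`c² = t⁴ - t² s² + s⁴`. -/
theorem not_isSquare_mul_add {a b c : ℕ} (ha : 0 < a) (hb : 0 < b) (hab : Nat.Coprime a b)
    (hc : c ^ 2 = a ^ 2 + a * b + b ^ 2) : ¬ IsSquare (b * (a + b)) := by
  rintro ⟨n, hn⟩
  have hcop : Nat.Coprime b (a + b) := by simpa using hab.symm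
  obtain ⟨s, hs⟩ := exists_eq_pow_of_mul_eq_pow (k := 2) (a := b) (b := a + b) (c := n)
    (Nat.isUnit_iff.2 hcop.gcd_eq_one) (by rw [hn, sq])
  obtain ⟨t, ht⟩ := exists_eq_pow_of_mul_eq_pow (k := 2) (a := a + b) (b := b) (c := n)
    (Nat.isUnit_iff.2 hcop.symm.gcd_eq_one) (by rw [mul_comm, hn, sq])
  have hst : IsCoprime (t : ℤ) (s : ℤ) := by
    rw [Nat.isCoprime_iff_coprime]
    rw [ht, hs] at hcop
    exact ((Nat.coprime_pow_left_iff two_pos _ _).1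
      ((Nat.coprime_pow_right_iff two_pos _ _).1 hcop)).symm
  have hs' : (b : ℤ) = s ^ 2 := by exact_mod_cast hs
  have ht' : (a : ℤ) + b = t ^ 2 := by exact_mod_cast ht
  have hc' : (c : ℤ) ^ 2 = a ^ 2 + a * b + b ^ 2 := by exact_mod_cast hc
  have := eq_of_quartic_eq_sq _ t s c rfl hst (by rintro h; simp [h] at ht'; omega)
    (by rintro h; simp [h] at hs'; omega) (by
      rw [hc', show (a : ℤ) = t ^ 2 - s ^ 2 by linarith, hs']; ring)
  omega

/-- Integer sides `X > Y` enclosing an angle `π/3` and opposite to `Z` have the form `g (a + b)`,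
`g a`, `g c` with coprime `a`, `b` and `c ^ 2 = a ^ 2 + a b + b ^ 2`. -/
theorem exists_coprime_params {X Y Z : ℕ} (hY : 0 < Y) (hXY : Y < X)
    (h : Z ^ 2 + X * Y = X ^ 2 + Y ^ 2) :
    ∃ a b c : ℕ, 0 < a ∧ 0 < b ∧ 0 < c ∧ Nat.Coprime a b ∧ c ^ 2 = a ^ 2 + a * b + b ^ 2 ∧
      X * a = Y * (a + b) := by
  obtain ⟨d, rfl⟩ : ∃ d, X = Y + d := Nat.exists_eq_add_of_le hXY.le
  have hd : 0 < d := by omega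
  obtain ⟨a, b, hab, hYa, hdb⟩ := Nat.exists_coprime Y d
  have hg : 0 < Nat.gcd Y d := Nat.gcd_pos_of_pos_left _ hY
  generalize Nat.gcd Y d = g at hYa hdb hg
  have ha : 0 < a := Nat.pos_of_ne_zero (by rintro rfl; simp at hYa; omega)
  have hb : 0 < b := Nat.pos_of_ne_zero (by rintro rfl; simp at hdb; omega)
  have hZ : Z ^ 2 = g ^ 2 * (a ^ 2 + a * b + b ^ 2) := by
    subst hYa hdb
    zify at h ⊢
    linear_combination h
  obtain ⟨c, rfl⟩ : g ∣ Z := (Nat.pow_dvd_pow_iff two_ne_zero).1 ⟨_, hZ⟩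
  have hc : c ^ 2 = a ^ 2 + a * b + b ^ 2 :=
    Nat.eq_of_mul_eq_mul_left (pow_pos hg 2) (by rw [← hZ]; ring)
  refine ⟨a, b, c, ha, hb, Nat.pos_of_ne_zero ?_, hab, hc, by rw [hYa, hdb]; ring⟩
  rintro rfl
  have := pow_pos ha 2
  omega

theorem not_isSquare_sq_mul {m n : ℕ} (hm : 0 < m) (hn : ¬ IsSquare n) :
    ¬ IsSquare (m ^ 2 * n) := by
  rintro ⟨k, hk⟩
  obtain ⟨l, rfl⟩ : m ∣ k := (Nat.pow_dvd_pow_iff two_ne_zero).1 ⟨n, by rw [sq, ← hk]⟩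
  exact hn ⟨l, Nat.eq_of_mul_eq_mul_left (pow_pos hm 2) (by rw [hk]; ring)⟩

/-! ### Dissections and the unit grid -/

/-- The set `S` is the union of `N` members of `𝒯` with pairwise disjoint interiors. -/
def Dissect {X : Type*} [TopologicalSpace X] (𝒯 : Set (Set X)) (S : Set X) (N : ℕ) : Prop :=
  ∃ P : Fin N → Set X, (∀ i, P i ∈ 𝒯) ∧ ⋃ i, P i = S ∧
    ∀ i j, i ≠ j → Disjoint (interior (P i)) (interior (P j))

namespace Dissect

section Topological

variable {X Y : Type*} [TopologicalSpace X] [TopologicalSpace Y] {𝒯 : Set (Set X)}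

theorem of_fintype {ι : Type*} [Fintype ι] {S : Set X} (P : ι → Set X) (h1 : ∀ i, P i ∈ 𝒯)
    (h2 : ⋃ i, P i = S) (h3 : ∀ i j, i ≠ j → Disjoint (interior (P i)) (interior (P j))) :
    Dissect 𝒯 S (Fintype.card ι) := by
  let e := (Fintype.equivFin ι).symm
  refine ⟨P ∘ e, fun i => h1 _, ?_, fun i j hij => h3 _ _ (e.injective.ne hij)⟩
  rw [← h2]
  exact e.surjective.iUnion_comp P

theorem single {S : Set X} (h : S ∈ 𝒯) : Dissect 𝒯 S 1 :=
  ⟨fun _ => S, fun _ => h, Set.iUnion_const S, fun i j hij => absurd (Subsingleton.elim i j) hij⟩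

theorem union {S S' : Set X} {m n : ℕ} (h : Dissect 𝒯 S m) (h' : Dissect 𝒯 S' n)
    (hd : Disjoint (interior S) (interior S')) : Dissect 𝒯 (S ∪ S') (m + n) := by
  obtain ⟨P, hP, hPS, hPd⟩ := h
  obtain ⟨P', hP', hPS', hPd'⟩ := h'
  have hs : ∀ i, interior (P i) ⊆ interior S :=
    fun i => interior_mono (hPS ▸ Set.subset_iUnion P i)
  have hs' : ∀ i, interior (P' i) ⊆ interior S' :=
    fun i => interior_mono (hPS' ▸ Set.subset_iUnion P' i)
  have := of_fintype (𝒯 := 𝒯) (S := S ∪ S') (Sum.elim P P') (by rintro (i | i) <;> simp [hP, hP'])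
    (by rw [Set.iUnion_sumElim, hPS, hPS'])
    (by
      rintro (i | i) (j | j) hij
      · exact hPd i j (by rintro rfl; exact hij rfl)
      · exact hd.mono (hs i) (hs' j)
      · exact hd.symm.mono (hs' i) (hs j)
      · exact hPd' i j (by rintro rfl; exact hij rfl))
  simpa using this

theorem image {𝒯' : Set (Set Y)} {S : Set X} {N : ℕ} (h : Dissect 𝒯 S N) (e : X ≃ₜ Y)
    (he : ∀ T ∈ 𝒯, e '' T ∈ 𝒯') : Dissect 𝒯' (e '' S) N := by
  obtain ⟨P, hP, hPS, hPd⟩ := h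
  refine ⟨fun i => e '' P i, fun i => he _ (hP i), by rw [← hPS, Set.image_iUnion], ?_⟩
  intro i j hij
  rw [← e.image_interior, ← e.image_interior]
  exact (Set.disjoint_image_iff e.injective).2 (hPd i j hij)

end Topological

/-- Two sets on different sides of a line have disjoint interiors. -/
theorem disjoint_interior_of_line {S S' : Set (ℝ × ℝ)} (α β γ : ℝ) (hne : α ^ 2 + β ^ 2 ≠ 0)
    (h : ∀ z ∈ S, α * z.1 + β * z.2 ≤ γ) (h' : ∀ z ∈ S', γ ≤ α * z.1 + β * z.2) :
    Disjoint (interior S) (interior S') := by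
  rw [Set.disjoint_left]
  intro z hz hz'
  have hU : interior S ∩ interior S' ∈ nhds z :=
    (isOpen_interior.inter isOpen_interior).mem_nhds ⟨hz, hz'⟩
  have hc : Continuous fun t : ℝ => (z.1 + t * α, z.2 + t * β) := by fun_prop
  have hU0 : interior S ∩ interior S' ∈ nhds ((fun t : ℝ => (z.1 + t * α, z.2 + t * β)) 0) := by
    simpa using hU
  have hev := hc.continuousAt.eventually hU0
  obtain ⟨t, ht, ht0⟩ := ((hev.filter_mono nhdsWithin_le_nhds).and
    (self_mem_nhdsWithin (s := ({0}ᶜ : Set ℝ)))).exists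
  have e1 := h _ (interior_subset hz)
  have e2 := h' _ (interior_subset hz')
  have e3 := h _ (interior_subset ht.1)
  have e4 := h' _ (interior_subset ht.2)
  simp only at e3 e4
  have : t * (α ^ 2 + β ^ 2) = 0 := by linarith
  rcases mul_eq_zero.1 this with h0 | h0
  · exact ht0 h0
  · exact hne h0

/-- Gluing two dissected sets along a line `α x + β y = γ`. -/
theorem glue {𝒯 : Set (Set (ℝ × ℝ))} {S S₁ S₂ : Set (ℝ × ℝ)} {m n N : ℕ} (h₁ : Dissect 𝒯 S₁ m)
    (h₂ : Dissect 𝒯 S₂ n) (α β γ : ℝ) (hne : α ^ 2 + β ^ 2 ≠ 0)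
    (hN : m + n = N)
    (h : ∀ x y, (x, y) ∈ S₁ ↔ (x, y) ∈ S ∧ α * x + β * y ≤ γ)
    (h' : ∀ x y, (x, y) ∈ S₂ ↔ (x, y) ∈ S ∧ γ ≤ α * x + β * y) : Dissect 𝒯 S N := by
  have := h₁.union h₂ (disjoint_interior_of_line α β γ hne (fun z hz => ((h _ _).1 hz).2)
    (fun z hz => ((h' _ _).1 hz).2))
  rw [hN] at this
  convert this using 1
  ext ⟨x, y⟩
  rw [Set.mem_union, h, h']
  rcases le_total (α * x + β * y) γ with hl | hl <;> tauto

end Dissect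

/-- The triangle `x ≥ x₀`, `y ≥ y₀`, `(x - x₀) + (y - y₀) ≤ k`. -/
def corner (x₀ y₀ k : ℝ) : Set (ℝ × ℝ) := {z | x₀ ≤ z.1 ∧ y₀ ≤ z.2 ∧ (z.1 - x₀) + (z.2 - y₀) ≤ k}

/-- The unit corner reflected in the origin and moved to the vertex `(x₀, y₀)`. -/
def coCorner (x₀ y₀ : ℝ) : Set (ℝ × ℝ) :=
  {z | z.1 ≤ x₀ ∧ z.2 ≤ y₀ ∧ (x₀ - z.1) + (y₀ - z.2) ≤ 1}

/-- The rectangle `[x₀, x₀ + w] × [y₀, y₀ + h]`. -/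
def box (x₀ y₀ w h : ℝ) : Set (ℝ × ℝ) :=
  {z | x₀ ≤ z.1 ∧ y₀ ≤ z.2 ∧ z.1 ≤ x₀ + w ∧ z.2 ≤ y₀ + h}

/-- The translates of the unit corner and of its reflection. -/
def unitCorners : Set (Set (ℝ × ℝ)) :=
  {T | ∃ x₀ y₀, T = corner x₀ y₀ 1 ∨ T = coCorner x₀ y₀}

theorem dissect_unitBox (x₀ y₀ : ℝ) : Dissect unitCorners (box x₀ y₀ 1 1) 2 := by
  refine Dissect.glue (Dissect.single ⟨x₀, y₀, Or.inl rfl⟩)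
    (Dissect.single ⟨x₀ + 1, y₀ + 1, Or.inr rfl⟩) 1 1 (x₀ + y₀ + 1) (by norm_num) rfl ?_ ?_
  all_goals
    intro x y
    simp only [corner, coCorner, box, Set.mem_ofPred_eq]
    constructor
    · rintro ⟨h1, h2, h3⟩
      refine ⟨⟨?_, ?_, ?_, ?_⟩, ?_⟩ <;> linarith
    · rintro ⟨⟨h1, h2, h3, h4⟩, h5⟩
      refine ⟨?_, ?_, ?_⟩ <;> linarith

theorem dissect_row (m : ℕ) (x₀ y₀ : ℝ) :
    Dissect unitCorners (box x₀ y₀ (m + 1) 1) (2 * (m + 1)) := by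
  induction m generalizing x₀ with
  | zero => simpa using dissect_unitBox x₀ y₀
  | succ m ih =>
    have hm : (0 : ℝ) ≤ m := m.cast_nonneg
    refine Dissect.glue (dissect_unitBox x₀ y₀) (ih (x₀ + 1)) 1 0 (x₀ + 1) (by norm_num)
      (by ring) ?_ ?_
    all_goals
      intro x y
      simp only [box, Set.mem_ofPred_eq]
      push_cast
      constructor
      · rintro ⟨h1, h2, h3, h4⟩
        refine ⟨⟨?_, ?_, ?_, ?_⟩, ?_⟩ <;> linarith
      · rintro ⟨⟨h1, h2, h3, h4⟩, h5⟩
        refine ⟨?_, ?_, ?_, ?_⟩ <;> linarith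

theorem dissect_box (m n : ℕ) (x₀ y₀ : ℝ) :
    Dissect unitCorners (box x₀ y₀ (m + 1) (n + 1)) (2 * (m + 1) * (n + 1)) := by
  induction n generalizing y₀ with
  | zero => simpa using dissect_row m x₀ y₀
  | succ n ih =>
    have hn : (0 : ℝ) ≤ n := n.cast_nonneg
    refine Dissect.glue (dissect_row m x₀ y₀) (ih (y₀ + 1)) 0 1 (y₀ + 1) (by norm_num)
      (by ring) ?_ ?_
    all_goals
      intro x y
      simp only [box, Set.mem_ofPred_eq]
      push_cast
      constructor
      · rintro ⟨h1, h2, h3, h4⟩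
        refine ⟨⟨?_, ?_, ?_, ?_⟩, ?_⟩ <;> linarith
      · rintro ⟨⟨h1, h2, h3, h4⟩, h5⟩
        refine ⟨?_, ?_, ?_, ?_⟩ <;> linarith

/-- The bottom strip of height `1` of a corner of size `k + 1` consists of `k` unit squares and a
unit corner. -/
theorem dissect_corner_strip (k : ℕ) (x₀ y₀ : ℝ) :
    Dissect unitCorners (corner x₀ y₀ (k + 1) ∩ {z | z.2 ≤ y₀ + 1}) (2 * k + 1) := by
  induction k generalizing x₀ with
  | zero =>
    convert Dissect.single (𝒯 := unitCorners) ⟨x₀, y₀, Or.inl rfl⟩ using 1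
    ext ⟨x, y⟩
    simp only [corner, Set.mem_inter_iff, Set.mem_ofPred_eq]
    constructor
    · rintro ⟨⟨h1, h2, h3⟩, h4⟩
      refine ⟨?_, ?_, ?_⟩ <;> push_cast at * <;> linarith
    · rintro ⟨h1, h2, h3⟩
      refine ⟨⟨?_, ?_, ?_⟩, ?_⟩ <;> push_cast at * <;> linarith
  | succ k ih =>
    have hk : (0 : ℝ) ≤ k := k.cast_nonneg
    refine Dissect.glue (dissect_unitBox x₀ y₀) (ih (x₀ + 1)) 1 0 (x₀ + 1) (by norm_num)
      (by ring) ?_ ?_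
    · intro x y
      simp only [corner, box, Set.mem_inter_iff, Set.mem_ofPred_eq]
      push_cast
      constructor
      · rintro ⟨h1, h2, h3, h4⟩
        refine ⟨⟨⟨?_, ?_, ?_⟩, ?_⟩, ?_⟩ <;> linarith
      · rintro ⟨⟨⟨h1, h2, h3⟩, h4⟩, h5⟩
        refine ⟨?_, ?_, ?_, ?_⟩ <;> linarith
    · intro x y
      simp only [corner, Set.mem_inter_iff, Set.mem_ofPred_eq]
      push_cast
      constructor
      · rintro ⟨⟨h1, h2, h3⟩, h4⟩
        refine ⟨⟨⟨?_, ?_, ?_⟩, ?_⟩, ?_⟩ <;> linarith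
      · rintro ⟨⟨⟨h1, h2, h3⟩, h4⟩, h5⟩
        refine ⟨⟨?_, ?_, ?_⟩, ?_⟩ <;> linarith

theorem dissect_corner (k : ℕ) (x₀ y₀ : ℝ) :
    Dissect unitCorners (corner x₀ y₀ (k + 1)) ((k + 1) ^ 2) := by
  induction k generalizing y₀ with
  | zero => simpa using Dissect.single (𝒯 := unitCorners) ⟨x₀, y₀, Or.inl rfl⟩
  | succ k ih =>
    have hk : (0 : ℝ) ≤ k := k.cast_nonneg
    refine Dissect.glue (dissect_corner_strip (k + 1) x₀ y₀) (ih (y₀ + 1)) 0 1 (y₀ + 1)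
      (by norm_num) (by ring) ?_ ?_
    all_goals
      intro x y
      simp only [corner, Set.mem_inter_iff, Set.mem_ofPred_eq]
      push_cast
      constructor
    · rintro ⟨⟨h1, h2, h3⟩, h4⟩
      refine ⟨⟨?_, ?_, ?_⟩, ?_⟩ <;> linarith
    · rintro ⟨⟨h1, h2, h3⟩, h4⟩
      refine ⟨⟨?_, ?_, ?_⟩, ?_⟩ <;> linarith
    · rintro ⟨h1, h2, h3⟩
      refine ⟨⟨?_, ?_, ?_⟩, ?_⟩ <;> linarith
    · rintro ⟨⟨h1, h2, h3⟩, h4⟩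
      refine ⟨?_, ?_, ?_⟩ <;> linarith

/-! ### Tiles in oblique coordinates -/

/-- The square of the length of `x e₁ + y e₂`, where `e₁`, `e₂` are unit vectors at angle `π/3`. -/
def normForm (z : ℝ × ℝ) : ℝ := z.1 ^ 2 + z.1 * z.2 + z.2 ^ 2

/-- The triangles with sides `a`, `b` enclosing the angle `2π/3`, in the coordinates of
`normForm`. -/
def tiles (a b : ℝ) : Set (Set (ℝ × ℝ)) :=
  {T | ∃ P : Fin 3 → ℝ × ℝ, normForm (P 1 - P 2) = a ^ 2 ∧ normForm (P 0 - P 2) = b ^ 2 ∧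
    normForm (P 1 - P 0) = a ^ 2 + a * b + b ^ 2 ∧ T = convexHull ℝ (Set.range P)}

/-- The linear automorphism of `ℝ × ℝ` with columns `u`, `v`. -/
noncomputable def columnEquiv (u v : ℝ × ℝ) (hD : u.1 * v.2 - u.2 * v.1 ≠ 0) :
    (ℝ × ℝ) ≃ₗ[ℝ] (ℝ × ℝ) where
  toFun z := z.1 • u + z.2 • v
  map_add' z w := by ext <;> simp <;> ring
  map_smul' t z := by ext <;> simp <;> ring
  invFun z := ((z.1 * v.2 - z.2 * v.1) / (u.1 * v.2 - u.2 * v.1),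
    (u.1 * z.2 - u.2 * z.1) / (u.1 * v.2 - u.2 * v.1))
  left_inv z := by ext <;> simp <;> rw [div_eq_iff hD] <;> ring
  right_inv z := by
    ext <;> simp <;>
      rw [div_mul_eq_mul_div, div_mul_eq_mul_div, ← add_div, div_eq_iff hD] <;> ring

theorem Dissect.image_affineEquiv {E F : Type*} [NormedAddCommGroup E] [NormedSpace ℝ E]
    [FiniteDimensional ℝ E] [NormedAddCommGroup F] [NormedSpace ℝ F] [FiniteDimensional ℝ F]
    {𝒯 : Set (Set E)} {𝒯' : Set (Set F)} {S : Set E} {N : ℕ} (h : Dissect 𝒯 S N) (e : E ≃ᵃ[ℝ] F)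
    (he : ∀ T ∈ 𝒯, e '' T ∈ 𝒯') : Dissect 𝒯' (e '' S) N :=
  h.image (AffineEquiv.toContinuousAffineEquiv e).toHomeomorph he

theorem AffineEquiv.image_convexHull_range {ι E F : Type*} [AddCommGroup E] [Module ℝ E]
    [AddCommGroup F] [Module ℝ F] (e : E ≃ᵃ[ℝ] F) (P : ι → E) :
    e '' convexHull ℝ (Set.range P) = convexHull ℝ (Set.range (e ∘ P)) := by
  rw [Set.range_comp]
  exact AffineMap.image_convexHull (e : E →ᵃ[ℝ] F) _

theorem convexHull_range_corner :
    convexHull ℝ (Set.range ![((0 : ℝ), (1 : ℝ)), (1, 0), (0, 0)]) = corner 0 0 1 := by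
  apply Set.Subset.antisymm
  · apply convexHull_min
    · rintro _ ⟨i, rfl⟩
      fin_cases i <;> simp [corner]
    · intro z hz w hw s t hs ht hst
      simp only [corner, Set.mem_ofPred_eq, sub_zero] at hz hw ⊢
      obtain ⟨h1, h2, h3⟩ := hz
      obtain ⟨h4, h5, h6⟩ := hw
      simp only [Prod.fst_add, Prod.smul_fst, smul_eq_mul, Prod.snd_add, Prod.smul_snd]
      refine ⟨by positivity, by positivity, ?_⟩
      nlinarith [mul_le_mul_of_nonneg_left h3 hs, mul_le_mul_of_nonneg_left h6 ht]
  · rintro ⟨x, y⟩ ⟨h1, h2, h3⟩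
    simp only [sub_zero] at h1 h2 h3
    set S := Set.range ![((0 : ℝ), (1 : ℝ)), (1, 0), (0, 0)]
    have m : ∀ i, ![((0 : ℝ), (1 : ℝ)), (1, 0), (0, 0)] i ∈ convexHull ℝ S :=
      fun i => subset_convexHull ℝ S ⟨i, rfl⟩
    have := (convex_convexHull ℝ S).sum_mem (t := Finset.univ) (w := ![y, x, 1 - x - y])
      (z := ![((0 : ℝ), (1 : ℝ)), (1, 0), (0, 0)])
      (by intro i _; fin_cases i <;> simp <;> linarith)
      (by simp [Fin.sum_univ_three]; ring) (fun i _ => m i)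
    simpa [Fin.sum_univ_three] using this

theorem AffineEquiv.image_eq_setOf {E F : Type*} [AddCommGroup E] [Module ℝ E]
    [AddCommGroup F] [Module ℝ F] (e : E ≃ᵃ[ℝ] F) (φ : F → E) (hφ : ∀ z, e (φ z) = z) (S : Set E) :
    e '' S = {z | φ z ∈ S} := by
  ext z
  constructor
  · rintro ⟨w, hw, rfl⟩
    have : φ (e w) = w := e.injective (hφ _)
    simpa [this] using hw
  · intro hz
    exact ⟨φ z, hz, hφ z⟩

/-- The affine automorphism `z ↦ p + z.1 u + z.2 v` of `ℝ × ℝ`. -/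
noncomputable def frameEquiv (p u v : ℝ × ℝ) (hD : u.1 * v.2 - u.2 * v.1 ≠ 0) :
    (ℝ × ℝ) ≃ᵃ[ℝ] (ℝ × ℝ) :=
  (columnEquiv u v hD).toAffineEquiv.trans (AffineEquiv.constVAdd ℝ (ℝ × ℝ) p)

theorem frameEquiv_apply (p u v : ℝ × ℝ) (hD : u.1 * v.2 - u.2 * v.1 ≠ 0) (z : ℝ × ℝ) :
    frameEquiv p u v hD z = p + (z.1 • u + z.2 • v) := rfl

theorem corner_eq_convexHull (x₀ y₀ : ℝ) : corner x₀ y₀ 1 =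
    convexHull ℝ (Set.range ![(x₀, y₀ + 1), (x₀ + 1, y₀), (x₀, y₀)]) := by
  have h := (frameEquiv (x₀, y₀) (1, 0) (0, 1) (by norm_num)).image_convexHull_range
    ![((0 : ℝ), (1 : ℝ)), (1, 0), (0, 0)]
  rw [convexHull_range_corner, AffineEquiv.image_eq_setOf _ (fun z => (z.1 - x₀, z.2 - y₀))
    (by intro z; ext <;> simp [frameEquiv_apply])] at h
  convert h using 1
  · ext z; simp [corner]
  · congr 2
    funext i
    fin_cases i <;> simp [frameEquiv_apply]

theorem coCorner_eq_convexHull (x₀ y₀ : ℝ) : coCorner x₀ y₀ =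
    convexHull ℝ (Set.range ![(x₀, y₀ - 1), (x₀ - 1, y₀), (x₀, y₀)]) := by
  have h := (frameEquiv (x₀, y₀) (-1, 0) (0, -1) (by norm_num)).image_convexHull_range
    ![((0 : ℝ), (1 : ℝ)), (1, 0), (0, 0)]
  rw [convexHull_range_corner, AffineEquiv.image_eq_setOf _ (fun z => (x₀ - z.1, y₀ - z.2))
    (by intro z; ext <;> simp [frameEquiv_apply])] at h
  convert h using 1
  · ext z; simp [coCorner, corner]
  · congr 2
    funext i
    fin_cases i <;> simp [frameEquiv_apply, sub_eq_add_neg]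

theorem normForm_neg (z : ℝ × ℝ) : normForm (-z) = normForm z := by
  simp [normForm]

/-- A dissection into unit corners is carried to a dissection into tiles when the axes are sent to
the two sides `u`, `v` of a tile enclosing the angle `2π/3`. -/
theorem Dissect.tiles_of_unitCorners {a b : ℝ} {S S' : Set (ℝ × ℝ)} {N : ℕ}
    (h : Dissect unitCorners S N) (p u v : ℝ × ℝ) (D : ℝ) (hD : u.1 * v.2 - u.2 * v.1 = D)
    (hD0 : D ≠ 0) (hu : normForm u = a ^ 2) (hv : normForm v = b ^ 2)
    (huv : normForm (u - v) = a ^ 2 + a * b + b ^ 2)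
    (hS : ∀ x y, (x, y) ∈ S' ↔ (((x - p.1) * v.2 - (y - p.2) * v.1) / D,
      (u.1 * (y - p.2) - u.2 * (x - p.1)) / D) ∈ S) :
    Dissect (tiles a b) S' N := by
  have hD' : u.1 * v.2 - u.2 * v.1 ≠ 0 := by rwa [hD]
  have := h.image_affineEquiv (𝒯' := tiles a b) (frameEquiv p u v hD') (by
    rintro _ ⟨x₀, y₀, rfl | rfl⟩
    · rw [corner_eq_convexHull, AffineEquiv.image_convexHull_range]
      refine ⟨_, ?_, ?_, ?_, rfl⟩
      · rw [← hu]; congr 1; ext <;> simp [frameEquiv_apply] <;> ring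
      · rw [← hv]; congr 1; ext <;> simp [frameEquiv_apply] <;> ring
      · rw [← huv]; congr 1; ext <;> simp [frameEquiv_apply] <;> ring
    · rw [coCorner_eq_convexHull, AffineEquiv.image_convexHull_range]
      refine ⟨_, ?_, ?_, ?_, rfl⟩
      · rw [← hu, ← normForm_neg]; congr 1; ext <;> simp [frameEquiv_apply] <;> ring
      · rw [← hv, ← normForm_neg]; congr 1; ext <;> simp [frameEquiv_apply] <;> ring
      · rw [← huv, ← normForm_neg]; congr 1; ext <;> simp [frameEquiv_apply] <;> ring)
  rw [AffineEquiv.image_eq_setOf _ (fun z => (((z.1 - p.1) * v.2 - (z.2 - p.2) * v.1) / D,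
      (u.1 * (z.2 - p.2) - u.2 * (z.1 - p.1)) / D)) (by
        intro z
        ext <;> simp [frameEquiv_apply] <;>
          rw [div_mul_eq_mul_div, div_mul_eq_mul_div, ← add_div, ← eq_sub_iff_add_eq',
            div_eq_iff hD0, ← hD] <;> ring)] at this
  rwa [show S' = _ from Set.ext fun z => hS z.1 z.2]

/-- Tile dissections may be moved by an affine isometry of the norm form; the new set is given as
a preimage under `z ↦ p + z.1 u + z.2 v`. -/
theorem Dissect.preimage {a b : ℝ} {S S' : Set (ℝ × ℝ)} {N : ℕ}
    (h : Dissect (tiles a b) S N) (p u v : ℝ × ℝ) (hD : u.1 * v.2 - u.2 * v.1 ≠ 0)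
    (hQ : ∀ z : ℝ × ℝ, normForm (z.1 • u + z.2 • v) = normForm z)
    (hS : ∀ x y, (x, y) ∈ S' ↔ p + (x • u + y • v) ∈ S) :
    Dissect (tiles a b) S' N := by
  have hQ' : ∀ z w, normForm ((frameEquiv p u v hD).symm z - (frameEquiv p u v hD).symm w) =
      normForm (z - w) := by
    intro z w
    obtain ⟨z, rfl⟩ := (frameEquiv p u v hD).surjective z
    obtain ⟨w, rfl⟩ := (frameEquiv p u v hD).surjective w
    rw [AffineEquiv.symm_apply_apply, AffineEquiv.symm_apply_apply, ← hQ]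
    congr 1
    ext <;> simp [frameEquiv_apply] <;> ring
  have := h.image_affineEquiv (𝒯' := tiles a b) (frameEquiv p u v hD).symm (by
    rintro _ ⟨P, h1, h2, h3, rfl⟩
    rw [AffineEquiv.image_convexHull_range]
    exact ⟨_, by rw [← h1]; exact hQ' _ _, by rw [← h2]; exact hQ' _ _,
      by rw [← h3]; exact hQ' _ _, rfl⟩)
  rw [AffineEquiv.image_eq_setOf _ (fun z => p + (z.1 • u + z.2 • v))
    (by intro z; rw [← frameEquiv_apply p u v hD, AffineEquiv.symm_apply_apply])] at this
  rwa [show S' = _ from Set.ext fun z => hS z.1 z.2]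

/-! ### Trapezoids -/

/-- The isosceles trapezoid with legs `h` and parallel sides `t` and `t + h`, the longer one on the
first axis, in the coordinates of `normForm`. -/
def trapezoid (h t : ℝ) : Set (ℝ × ℝ) := {z | 0 ≤ z.2 ∧ z.2 ≤ h ∧ 0 ≤ z.1 ∧ z.1 + z.2 ≤ t + h}

/-- Clears the denominators in a corner given by Cramer's rule, where `D` is the determinant of the
frame and `X / D = X' / p`, `Y / D = Y' / q`. -/
theorem mem_corner_div {X Y D k X' Y' p q : ℝ} (hD : D ≠ 0) (hp : 0 < p) (hq : 0 < q)
    (hX : p * X = D * X') (hY : q * Y = D * Y') :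
    (X / D, Y / D) ∈ corner 0 0 k ↔ 0 ≤ X' ∧ 0 ≤ Y' ∧ q * X' + p * Y' ≤ k * (p * q) := by
  have e1 : X / D = X' / p := by rw [div_eq_div_iff hD hp.ne']; linarith
  have e2 : Y / D = Y' / q := by rw [div_eq_div_iff hD hq.ne']; linarith
  rw [e1, e2]
  simp only [corner, Set.mem_ofPred_eq, sub_zero]
  rw [le_div_iff₀ hp, le_div_iff₀ hq, zero_mul, zero_mul, div_add_div _ _ hp.ne' hq.ne',
    div_le_iff₀ (mul_pos hp hq), mul_comm X' q]

/-- The analogue of `mem_corner_div` for rectangles. -/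
theorem mem_box_div {X Y D m n X' Y' p q : ℝ} (hD : D ≠ 0) (hp : 0 < p) (hq : 0 < q)
    (hX : p * X = D * X') (hY : q * Y = D * Y') :
    (X / D, Y / D) ∈ box 0 0 m n ↔ 0 ≤ X' ∧ 0 ≤ Y' ∧ X' ≤ m * p ∧ Y' ≤ n * q := by
  have e1 : X / D = X' / p := by rw [div_eq_div_iff hD hp.ne']; linarith
  have e2 : Y / D = Y' / q := by rw [div_eq_div_iff hD hq.ne']; linarith
  rw [e1, e2]
  simp only [box, Set.mem_ofPred_eq, zero_add]
  rw [le_div_iff₀ hp, le_div_iff₀ hq, zero_mul, zero_mul, div_le_iff₀ hp, div_le_iff₀ hq]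

theorem dissect_corner_of_pos {k : ℕ} (hk : 0 < k) :
    Dissect unitCorners (corner 0 0 k) (k ^ 2) := by
  obtain ⟨k, rfl⟩ := Nat.exists_eq_succ_of_ne_zero hk.ne'
  simpa using dissect_corner k 0 0

theorem dissect_box_of_pos {m n : ℕ} (hm : 0 < m) (hn : 0 < n) :
    Dissect unitCorners (box 0 0 m n) (2 * m * n) := by
  obtain ⟨m, rfl⟩ := Nat.exists_eq_succ_of_ne_zero hm.ne'
  obtain ⟨n, rfl⟩ := Nat.exists_eq_succ_of_ne_zero hn.ne'
  simpa using dissect_box m n 0 0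

/-- Three triangles similar to the tile, enlarged by the factors `a`, `b` and `c`, form an isosceles
trapezoid: the one enlarged by `c` stands on the long base, its apex divides the short base into
`b ^ 2` and `a ^ 2`, and the other two are attached to its sides `b * c` and `a * c`. -/
theorem dissect_trapezoid_base {a b c : ℕ} (ha : 0 < a) (hb : 0 < b) (hc0 : 0 < c)
    (hc : c ^ 2 = a ^ 2 + a * b + b ^ 2) :
    Dissect (tiles a b) (trapezoid (a * b) (a ^ 2 + b ^ 2)) (a ^ 2 + b ^ 2 + c ^ 2) := by
  have ha' : (0 : ℝ) < a := Nat.cast_pos.2 ha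
  have hb' : (0 : ℝ) < b := Nat.cast_pos.2 hb
  have hc0' : (0 : ℝ) < c := Nat.cast_pos.2 hc0
  have hc' : (c : ℝ) ^ 2 = a ^ 2 + a * b + b ^ 2 := by exact_mod_cast hc
  have hA : Dissect (tiles a b)
      {z | z.2 ≤ a * b ∧ z.1 + z.2 ≤ c ^ 2 ∧ (b : ℝ) * c ^ 2 ≤ b * z.1 + (a + b) * z.2}
      (a ^ 2) := by
    refine (dissect_corner_of_pos ha).tiles_of_unitCorners (a ^ 2 + b ^ 2, a * b) (-a, 0) (b, -b)
      (a * b) (by simp) (by positivity) (by simp [normForm]) (by simp [normForm]; ring)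
      (by simp [normForm]; ring) ?_
    intro x y
    rw [mem_corner_div (X' := c ^ 2 - x - y) (Y' := a * b - y) (by positivity) ha' hb'
      (by simp only; rw [hc']; ring) (by simp only; ring)]
    simp only [Set.mem_ofPred_eq]
    constructor
    · rintro ⟨h1, h2, h3⟩
      refine ⟨?_, ?_, ?_⟩ <;> linarith
    · rintro ⟨h1, h2, h3⟩
      refine ⟨?_, ?_, ?_⟩ <;> linarith
  have hB : Dissect (tiles a b)
      {z | 0 ≤ z.1 ∧ z.2 ≤ a * b ∧ (a : ℝ) * z.1 ≤ b * z.2} (b ^ 2) := by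
    refine (dissect_corner_of_pos hb).tiles_of_unitCorners (0, a * b) (0, -a) (b, 0)
      (a * b) (by simp) (by positivity) (by simp [normForm]) (by simp [normForm])
      (by simp [normForm]; ring) ?_
    intro x y
    rw [mem_corner_div (X' := a * b - y) (Y' := x) (by positivity) ha' hb'
      (by simp only; ring) (by simp only; ring)]
    simp only [Set.mem_ofPred_eq]
    constructor
    · rintro ⟨h1, h2, h3⟩
      refine ⟨?_, ?_, ?_⟩ <;> linarith
    · rintro ⟨h1, h2, h3⟩
      refine ⟨?_, ?_, ?_⟩ <;> linarith
  have hC : Dissect (tiles a b)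
      {z | 0 ≤ z.2 ∧ (b : ℝ) * z.2 ≤ a * z.1 ∧ (b : ℝ) * z.1 + (a + b) * z.2 ≤ b * c ^ 2}
      (c ^ 2) := by
    refine (dissect_corner_of_pos hc0).tiles_of_unitCorners (b ^ 2, a * b)
      ((a ^ 2 + a * b) / c, -(a * b) / c) (-b ^ 2 / c, -(a * b) / c)
      (-(a * b)) ?_ (neg_ne_zero.2 (by positivity)) ?_ ?_ ?_ ?_
    · simp only; field_simp; rw [hc']; ring
    · simp only [normForm]; field_simp; rw [hc']; ring
    · simp only [normForm]; field_simp; rw [hc']; ring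
    · simp only [normForm, Prod.fst_sub, Prod.snd_sub]; field_simp; rw [hc']; ring
    intro x y
    rw [mem_corner_div (X' := a * x - b * y) (Y' := b * c ^ 2 - b * x - (a + b) * y) (p := a * c)
      (q := b * c) (neg_ne_zero.2 (by positivity)) (by positivity) (by positivity)
      (by simp only; field_simp; ring)
      (by simp only; field_simp; rw [hc']; ring)]
    simp only [Set.mem_ofPred_eq]
    have e : b * c * (a * x - b * y) + a * c * (b * c ^ 2 - b * x - (a + b) * y) =
      c * (a * c * (b * c)) - c * c ^ 2 * y := by linear_combination c * y * hc'
    rw [e]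
    have e2 : (c : ℝ) * (a * c * (b * c)) - c * c ^ 2 * y ≤ c * (a * c * (b * c)) ↔ 0 ≤ y := by
      rw [sub_le_self_iff, mul_nonneg_iff_of_pos_left (by positivity)]
    rw [e2]
    constructor
    · rintro ⟨h1, h2, h3⟩
      refine ⟨?_, ?_, ?_⟩ <;> linarith
    · rintro ⟨h1, h2, h3⟩
      refine ⟨?_, ?_, ?_⟩ <;> linarith
  -- the two triangles meet along the line through `0` and the apex `(b ^ 2, a * b)`
  have hBC : Dissect (tiles a b) (trapezoid (a * b) (a ^ 2 + b ^ 2) ∩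
      {z | (b : ℝ) * z.1 + (a + b) * z.2 ≤ b * c ^ 2}) (b ^ 2 + c ^ 2) := by
    refine Dissect.glue hB hC a (-b) 0 (by positivity) rfl ?_ ?_
    · intro x y
      simp only [trapezoid, Set.mem_inter_iff, Set.mem_ofPred_eq]
      constructor
      · rintro ⟨h1, h2, h3⟩
        have hx : x ≤ b ^ 2 := by
          refine le_of_mul_le_mul_left ?_ ha'
          calc a * x ≤ b * y := h3
            _ ≤ b * (a * b) := mul_le_mul_of_nonneg_left h2 hb'.le
            _ = a * b ^ 2 := by ring
        have hy : 0 ≤ y := by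
          refine nonneg_of_mul_nonneg_right (a := (b : ℝ)) ?_ hb'
          exact (mul_nonneg ha'.le h1).trans h3
        refine ⟨⟨⟨hy, h2, h1, by nlinarith⟩, ?_⟩, by linarith⟩
        rw [hc']
        nlinarith [mul_le_mul_of_nonneg_left hx hb'.le,
          mul_le_mul_of_nonneg_left h2 (add_pos ha' hb').le]
      · rintro ⟨⟨⟨h1, h2, h3, h4⟩, h5⟩, h6⟩
        exact ⟨h3, h2, by linarith⟩
    · intro x y
      simp only [trapezoid, Set.mem_inter_iff, Set.mem_ofPred_eq]
      constructor
      · rintro ⟨h1, h2, h3⟩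
        have hx : 0 ≤ x := by
          refine nonneg_of_mul_nonneg_right (a := (a : ℝ)) ?_ ha'
          exact (mul_nonneg hb'.le h1).trans h2
        have hy : y ≤ a * b := by
          refine le_of_mul_le_mul_left (a := (c : ℝ) ^ 2) ?_ (by positivity)
          have e1 := mul_le_mul_of_nonneg_left h2 hb'.le
          have e2 := mul_le_mul_of_nonneg_left h3 ha'.le
          have e3 : (c : ℝ) ^ 2 * y = b * (b * y) + a * ((a + b) * y) := by rw [hc']; ring
          rw [e3]
          linarith
        have hxy : x + y ≤ c ^ 2 := by
          refine le_of_mul_le_mul_left (a := (b : ℝ)) ?_ hb'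
          have := mul_nonneg ha'.le h1
          linarith
        exact ⟨⟨⟨h1, hy, hx, by linarith⟩, h3⟩, by linarith⟩
      · rintro ⟨⟨⟨h1, h2, h3, h4⟩, h5⟩, h6⟩
        exact ⟨h1, by linarith, h5⟩
  refine Dissect.glue hBC hA b (a + b) (b * c ^ 2) (by positivity) (by ring) ?_ ?_
  · intro x y
    rfl
  · intro x y
    simp only [trapezoid, Set.mem_ofPred_eq]
    constructor
    · rintro ⟨h1, h2, h3⟩
      have hy : 0 ≤ y := by
        refine nonneg_of_mul_nonneg_right (a := (a : ℝ)) ?_ ha'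
        have := mul_le_mul_of_nonneg_left h2 hb'.le
        linarith
      have hx : 0 ≤ x := by
        refine nonneg_of_mul_nonneg_right (a := (b : ℝ)) ?_ hb'
        have e1 := mul_le_mul_of_nonneg_left h1 (add_pos ha' hb').le
        rw [hc'] at h3
        have : (0 : ℝ) ≤ b ^ 3 := by positivity
        nlinarith
      exact ⟨⟨hy, h1, hx, by linarith⟩, h3⟩
    · rintro ⟨⟨h1, h2, h3, h4⟩, h5⟩
      exact ⟨h2, by linarith, h5⟩

/-- A parallelogram with an angle `π/3` and sides `k a`, `a b` is cut into parallelograms with sides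
`a`, `b`, each consisting of two tiles. -/
theorem dissect_box_mul_left {a b k : ℕ} (ha : 0 < a) (hb : 0 < b) (hk : 0 < k) :
    Dissect (tiles a b) (box 0 0 (k * a) (a * b)) (2 * k * a) := by
  have ha' : (0 : ℝ) < a := Nat.cast_pos.2 ha
  have hb' : (0 : ℝ) < b := Nat.cast_pos.2 hb
  refine (dissect_box_of_pos hk ha).tiles_of_unitCorners (0, a * b) (a, 0) (0, -b)
    (-(a * b)) (by simp) (neg_ne_zero.2 (by positivity)) (by simp [normForm])
    (by simp [normForm]) (by simp [normForm]) ?_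
  intro x y
  rw [mem_box_div (X' := x) (Y' := a * b - y) (neg_ne_zero.2 (by positivity)) ha' hb'
    (by simp only; ring) (by simp only; ring)]
  simp only [box, Set.mem_ofPred_eq]
  constructor
  · rintro ⟨h1, h2, h3, h4⟩
    refine ⟨?_, ?_, ?_, ?_⟩ <;> linarith
  · rintro ⟨h1, h2, h3, h4⟩
    refine ⟨?_, ?_, ?_, ?_⟩ <;> linarith

/-- As `dissect_box_mul_left`, with the sides `a`, `b` of the small parallelograms exchanged. -/
theorem dissect_box_mul_right {a b k : ℕ} (ha : 0 < a) (hb : 0 < b) (hk : 0 < k) :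
    Dissect (tiles a b) (box 0 0 (k * b) (a * b)) (2 * b * k) := by
  have ha' : (0 : ℝ) < a := Nat.cast_pos.2 ha
  have hb' : (0 : ℝ) < b := Nat.cast_pos.2 hb
  refine (dissect_box_of_pos hb hk).tiles_of_unitCorners (0, a * b) (0, -a) (b, 0)
    (a * b) (by simp) (by positivity) (by simp [normForm])
    (by simp [normForm]) (by simp [normForm]; ring) ?_
  intro x y
  rw [mem_box_div (X' := a * b - y) (Y' := x) (by positivity) ha' hb'
    (by simp only; ring) (by simp only; ring)]
  simp only [box, Set.mem_ofPred_eq]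
  constructor
  · rintro ⟨h1, h2, h3, h4⟩
    refine ⟨?_, ?_, ?_, ?_⟩ <;> linarith
  · rintro ⟨h1, h2, h3, h4⟩
    refine ⟨?_, ?_, ?_, ?_⟩ <;> linarith

theorem Dissect.translate {a b : ℝ} {S S' : Set (ℝ × ℝ)} {N : ℕ} (h : Dissect (tiles a b) S N)
    (s t : ℝ) (hS : ∀ x y, (x, y) ∈ S' ↔ (x - s, y - t) ∈ S) : Dissect (tiles a b) S' N := by
  refine h.preimage (-s, -t) (1, 0) (0, 1) (by norm_num) (by simp) ?_
  intro x y
  rw [hS]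
  simp [sub_eq_neg_add]

/-- A parallelogram attached to a leg turns a trapezoid into a wider one. -/
theorem Dissect.widen_trapezoid {a b h t w : ℝ} {m n : ℕ} (hw : 0 ≤ w) (ht : 0 ≤ t)
    (hT : Dissect (tiles a b) (trapezoid h t) n) (hB : Dissect (tiles a b) (box 0 0 w h) m) :
    Dissect (tiles a b) (trapezoid h (t + w)) (n + m) := by
  have hT' : Dissect (tiles a b) {z | 0 ≤ z.2 ∧ z.2 ≤ h ∧ w ≤ z.1 ∧ z.1 + z.2 ≤ t + w + h} n := by
    refine hT.translate w 0 fun x y => ?_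
    simp only [trapezoid, Set.mem_ofPred_eq]
    constructor
    · rintro ⟨h1, h2, h3, h4⟩
      refine ⟨?_, ?_, ?_, ?_⟩ <;> linarith
    · rintro ⟨h1, h2, h3, h4⟩
      refine ⟨?_, ?_, ?_, ?_⟩ <;> linarith
  refine Dissect.glue hB hT' 1 0 w (by norm_num) (add_comm _ _) ?_ ?_
  · intro x y
    simp only [trapezoid, box, Set.mem_ofPred_eq]
    constructor
    · rintro ⟨h1, h2, h3, h4⟩
      refine ⟨⟨?_, ?_, ?_, ?_⟩, ?_⟩ <;> linarith
    · rintro ⟨⟨h1, h2, h3, h4⟩, h5⟩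
      refine ⟨?_, ?_, ?_, ?_⟩ <;> linarith
  · intro x y
    simp only [trapezoid, Set.mem_ofPred_eq]
    constructor
    · rintro ⟨h1, h2, h3, h4⟩
      refine ⟨⟨?_, ?_, ?_, ?_⟩, ?_⟩ <;> linarith
    · rintro ⟨⟨h1, h2, h3, h4⟩, h5⟩
      refine ⟨?_, ?_, ?_, ?_⟩ <;> linarith

/-- The base trapezoid is widened by parallelograms of both kinds to a trapezoid whose parallel
sides are multiples of the leg `a * b`. -/
theorem dissect_trapezoid_layer {a b c j : ℕ} (ha : 0 < a) (hb : 0 < b) (hc0 : 0 < c)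
    (hc : c ^ 2 = a ^ 2 + a * b + b ^ 2) (hj : a + b + 2 ≤ j) :
    Dissect (tiles a b) (trapezoid (a * b) (j * (a * b))) (a * b * (1 + 2 * j)) := by
  -- `j a b - a² - b²` is the sum of `a ((a + 1) b - a)` and `b ((j - a - 1) a - b)`
  obtain ⟨i, rfl⟩ : ∃ i, j = a + 1 + i := ⟨j - (a + 1), by omega⟩
  have hi : b + 1 ≤ i := by omega
  obtain ⟨x, hx⟩ : ∃ x, (a + 1) * b = a + x := Nat.exists_eq_add_of_le (by nlinarith)
  obtain ⟨y, hy⟩ : ∃ y, i * a = b + y := Nat.exists_eq_add_of_le (by nlinarith)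
  have hx0 : 0 < x := by nlinarith
  have hy0 : 0 < y := by nlinarith
  have h := ((dissect_trapezoid_base ha hb hc0 hc).widen_trapezoid (by positivity) (by positivity)
    (dissect_box_mul_left ha hb hx0)).widen_trapezoid (by positivity) (by positivity)
    (dissect_box_mul_right ha hb hy0)
  have hx' : ((a : ℝ) + 1) * b = a + x := by exact_mod_cast hx
  have hy' : (i : ℝ) * a = b + y := by exact_mod_cast hy
  convert h using 1
  · congr 1
    push_cast
    linear_combination a * hx' + b * hy'
  · zify at hx hy hc ⊢
    linear_combination 2 * a * hx + 2 * b * hy - hc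

/-- Layers of height `a * b` are stacked to a trapezoid whose leg is any multiple of `a * b`. -/
theorem dissect_trapezoid_stack {a b c j : ℕ} (ha : 0 < a) (hb : 0 < b) (hc0 : 0 < c)
    (hc : c ^ 2 = a ^ 2 + a * b + b ^ 2) (hj : a + b + 2 ≤ j) (n : ℕ) :
    Dissect (tiles a b) (trapezoid ((n + 1) * (a * b)) (j * (a * b)))
      (a * b * ((n + 1) ^ 2 + 2 * (n + 1) * j)) := by
  induction n with
  | zero => simpa using dissect_trapezoid_layer ha hb hc0 hc hj
  | succ n ih =>
    have hab : (0 : ℝ) ≤ a * b := by positivity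
    have hn : (0 : ℝ) ≤ n * (a * b) := by positivity
    have h1 := dissect_trapezoid_layer ha hb hc0 hc (j := j + (n + 1)) (by omega)
    have h2 : Dissect (tiles a b) {z | (a * b : ℝ) ≤ z.2 ∧ z.2 ≤ (n + 2) * (a * b) ∧ 0 ≤ z.1 ∧
        z.1 + z.2 ≤ j * (a * b) + (n + 2) * (a * b)} (a * b * ((n + 1) ^ 2 + 2 * (n + 1) * j)) := by
      refine ih.translate 0 (a * b) fun x y => ?_
      simp only [trapezoid, Set.mem_ofPred_eq]
      constructor
      · rintro ⟨h1, h2, h3, h4⟩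
        refine ⟨?_, ?_, ?_, ?_⟩ <;> linarith
      · rintro ⟨h1, h2, h3, h4⟩
        refine ⟨?_, ?_, ?_, ?_⟩ <;> linarith
    refine Dissect.glue h1 h2 0 1 (a * b) (by norm_num) (by ring) ?_ ?_
    all_goals
      intro x y
      simp only [trapezoid, Set.mem_ofPred_eq]
      push_cast
      constructor
      · rintro ⟨h1, h2, h3, h4⟩
        refine ⟨⟨?_, ?_, ?_, ?_⟩, ?_⟩ <;> linarith
      · rintro ⟨⟨h1, h2, h3, h4⟩, h5⟩
        refine ⟨?_, ?_, ?_, ?_⟩ <;> linarith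

/-- Disjointness of interiors passes to a union with a closed set, although the interior of the
union may be larger than the union of the interiors. -/
theorem disjoint_interior_union {X : Type*} [TopologicalSpace X] {A B C : Set X}
    (hB : IsClosed B) (h1 : Disjoint (interior A) (interior B))
    (h2 : Disjoint (interior A) (interior C)) : Disjoint (interior A) (interior (B ∪ C)) := by
  rw [Set.disjoint_left]
  intro z hzA hz
  have hzB : z ∈ B := by
    by_contra hzB
    have hz' : z ∈ interior C := by
      rw [mem_interior]
      refine ⟨interior (B ∪ C) ∩ Bᶜ, ?_, isOpen_interior.inter hB.isOpen_compl, hz, hzB⟩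
      rintro w ⟨hw, hwB⟩
      exact (interior_subset hw).resolve_left hwB
    exact Set.disjoint_left.1 h2 hzA hz'
  have hsub : interior A ∩ interior (B ∪ C) ⊆ B := by
    rintro w ⟨hwA, hw⟩
    by_contra hwB
    refine Set.disjoint_left.1 h2 hwA ?_
    rw [mem_interior]
    refine ⟨interior (B ∪ C) ∩ Bᶜ, ?_, isOpen_interior.inter hB.isOpen_compl, hw, hwB⟩
    rintro v ⟨hv, hvB⟩
    exact (interior_subset hv).resolve_left hvB
  exact Set.disjoint_left.1 h1 hzA
    (mem_interior.2 ⟨_, hsub, isOpen_interior.inter isOpen_interior, hzA, hz⟩)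

/-! ### Equilateral triangles and triangles with an angle `π/3` -/

/-- An equilateral triangle is cut into three isosceles trapezoids by the segments that join an
inner point to the sides and run parallel to the sides, in cyclic order. -/
theorem dissect_equilateral {a b : ℝ} {h₁ h₂ h₃ : ℝ} {n₁ n₂ n₃ : ℕ} (h₁0 : 0 ≤ h₁) (h₂0 : 0 ≤ h₂)
    (h₃0 : 0 ≤ h₃) (t₁ : Dissect (tiles a b) (trapezoid h₁ h₂) n₁)
    (t₂ : Dissect (tiles a b) (trapezoid h₂ h₃) n₂)
    (t₃ : Dissect (tiles a b) (trapezoid h₃ h₁) n₃) :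
    Dissect (tiles a b) (corner 0 0 (h₁ + h₂ + h₃)) (n₁ + n₂ + n₃) := by
  have d₂ : Dissect (tiles a b)
      {z | 0 ≤ z.1 ∧ z.1 ≤ h₂ ∧ h₁ ≤ z.2 ∧ z.1 + z.2 ≤ h₁ + h₂ + h₃} n₂ := by
    refine t₂.preimage (h₁ + h₂ + h₃, 0) (-1, 1) (-1, 0) (by norm_num)
      (by intro z; simp [normForm]; ring) fun x y => ?_
    simp only [trapezoid, Set.mem_ofPred_eq, Prod.fst_add, Prod.snd_add, Prod.smul_fst,
      Prod.smul_snd, smul_eq_mul]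
    constructor
    · rintro ⟨h1, h2, h3, h4⟩
      refine ⟨?_, ?_, ?_, ?_⟩ <;> linarith
    · rintro ⟨h1, h2, h3, h4⟩
      refine ⟨?_, ?_, ?_, ?_⟩ <;> linarith
  have d₃ : Dissect (tiles a b)
      {z | h₂ ≤ z.1 ∧ 0 ≤ z.2 ∧ h₁ + h₂ ≤ z.1 + z.2 ∧ z.1 + z.2 ≤ h₁ + h₂ + h₃} n₃ := by
    refine t₃.preimage (0, h₁ + h₂ + h₃) (0, -1) (1, -1) (by norm_num)
      (by intro z; simp [normForm]; ring) fun x y => ?_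
    simp only [trapezoid, Set.mem_ofPred_eq, Prod.fst_add, Prod.snd_add, Prod.smul_fst,
      Prod.smul_snd, smul_eq_mul]
    constructor
    · rintro ⟨h1, h2, h3, h4⟩
      refine ⟨?_, ?_, ?_, ?_⟩ <;> linarith
    · rintro ⟨h1, h2, h3, h4⟩
      refine ⟨?_, ?_, ?_, ?_⟩ <;> linarith
  have d₂₃ := d₂.union d₃ (Dissect.disjoint_interior_of_line 1 0 h₂ (by norm_num)
    (by rintro z ⟨h1, h2, h3, h4⟩; linarith) (by rintro z ⟨h1, h2, h3, h4⟩; linarith))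
  have hclosed : IsClosed
      {z : ℝ × ℝ | 0 ≤ z.1 ∧ z.1 ≤ h₂ ∧ h₁ ≤ z.2 ∧ z.1 + z.2 ≤ h₁ + h₂ + h₃} :=
    (isClosed_le continuous_const continuous_fst).inter
      ((isClosed_le continuous_fst continuous_const).inter
        ((isClosed_le continuous_const continuous_snd).inter
          (isClosed_le (continuous_fst.add continuous_snd) continuous_const)))
  have d := t₁.union d₂₃ (disjoint_interior_union hclosed
    (Dissect.disjoint_interior_of_line 0 1 h₁ (by norm_num)
      (by rintro z ⟨h1, h2, h3, h4⟩; linarith) (by rintro z ⟨h1, h2, h3, h4⟩; linarith))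
    (Dissect.disjoint_interior_of_line 1 1 (h₁ + h₂) (by norm_num)
      (by rintro z ⟨h1, h2, h3, h4⟩; linarith) (by rintro z ⟨h1, h2, h3, h4⟩; linarith)))
  rw [← add_assoc] at d
  convert d using 1
  ext ⟨x, y⟩
  simp only [corner, trapezoid, Set.mem_union, Set.mem_ofPred_eq, sub_zero]
  constructor
  · rintro ⟨h1, h2, h3⟩
    rcases le_total y h₁ with hy | hy
    · rcases le_total (x + y) (h₁ + h₂) with hxy | hxy
      · exact Or.inl ⟨h2, hy, h1, by linarith⟩
      · exact Or.inr (Or.inr ⟨by linarith, h2, hxy, h3⟩)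
    · rcases le_total x h₂ with hx | hx
      · exact Or.inr (Or.inl ⟨h1, hx, hy, h3⟩)
      · exact Or.inr (Or.inr ⟨hx, h2, by linarith, h3⟩)
  · rintro (⟨h1, h2, h3, h4⟩ | ⟨h1, h2, h3, h4⟩ | ⟨h1, h2, h3, h4⟩) <;>
      refine ⟨?_, ?_, ?_⟩ <;> linarith

theorem dissect_equilateral_of_le {a b c m : ℕ} (ha : 0 < a) (hb : 0 < b) (hc0 : 0 < c)
    (hc : c ^ 2 = a ^ 2 + a * b + b ^ 2) (hm : 3 * (a + b + 2) ≤ m) :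
    Dissect (tiles a b) (corner 0 0 (m * (a * b))) (m ^ 2 * (a * b)) := by
  obtain ⟨k, rfl⟩ : ∃ k, m = (a + b + 1 + 1) + (a + b + 1 + 1) + (k + 1) :=
    ⟨m - 2 * (a + b + 2) - 1, by omega⟩
  have h := dissect_equilateral (h₃ := (k + 1) * (a * b))
    (by positivity) (by positivity) (by positivity)
    (dissect_trapezoid_stack ha hb hc0 hc (j := a + b + 1 + 1) (by omega) (a + b + 1))
    (by simpa using dissect_trapezoid_stack ha hb hc0 hc (j := k + 1) (by omega) (a + b + 1))
    (by simpa using dissect_trapezoid_stack ha hb hc0 hc (j := a + b + 1 + 1) (by omega) k)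
  convert h using 1
  · congr 1
    push_cast
    ring
  · ring

/-- The triangle with sides `m b (a + b)` and `m a b` on the axes is an equilateral triangle
together with the tile enlarged by `m b`. -/
theorem dissect_triangle {a b c m : ℕ} (ha : 0 < a) (hb : 0 < b) (hc0 : 0 < c)
    (hc : c ^ 2 = a ^ 2 + a * b + b ^ 2) (hm : 3 * (a + b + 2) ≤ m) :
    Dissect (tiles a b)
      {z | 0 ≤ z.1 ∧ 0 ≤ z.2 ∧ (a : ℝ) * z.1 + (a + b) * z.2 ≤ m * (a * b * (a + b))}
      (m ^ 2 * (b * (a + b))) := by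
  have ha' : (0 : ℝ) < a := Nat.cast_pos.2 ha
  have hb' : (0 : ℝ) < b := Nat.cast_pos.2 hb
  have hm0 : 0 < m := by omega
  have hE := dissect_equilateral_of_le ha hb hc0 hc hm
  have hR : Dissect (tiles a b) {z | 0 ≤ z.2 ∧ (m * (a * b) : ℝ) ≤ z.1 + z.2 ∧
      (a : ℝ) * z.1 + (a + b) * z.2 ≤ m * (a * b * (a + b))} ((m * b) ^ 2) := by
    refine (dissect_corner_of_pos (Nat.mul_pos hm0 hb)).tiles_of_unitCorners (m * (a * b), 0)
      (-a, a) (b, 0) (-(a * b)) (by simp) (neg_ne_zero.2 (by positivity))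
      (by simp [normForm]; ring) (by simp [normForm]) (by simp [normForm]; ring) ?_
    intro x y
    rw [mem_corner_div (X' := y) (Y' := x + y - m * (a * b)) (neg_ne_zero.2 (by positivity)) ha' hb'
      (by simp only; ring) (by simp only; ring)]
    simp only [Set.mem_ofPred_eq]
    push_cast
    constructor
    · rintro ⟨h1, h2, h3⟩
      refine ⟨?_, ?_, ?_⟩ <;> linarith
    · rintro ⟨h1, h2, h3⟩
      refine ⟨?_, ?_, ?_⟩ <;> linarith
  refine Dissect.glue hE hR 1 1 (m * (a * b)) (by norm_num) (by ring) ?_ ?_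
  · intro x y
    simp only [corner, Set.mem_ofPred_eq, sub_zero, one_mul]
    constructor
    · rintro ⟨h1, h2, h3⟩
      refine ⟨⟨h1, h2, ?_⟩, h3⟩
      have := mul_le_mul_of_nonneg_left h3 (add_pos ha' hb').le
      have := mul_nonneg hb'.le h1
      linarith
    · rintro ⟨⟨h1, h2, h3⟩, h4⟩
      exact ⟨h1, h2, h4⟩
  · intro x y
    simp only [Set.mem_ofPred_eq, one_mul]
    constructor
    · rintro ⟨h1, h2, h3⟩
      refine ⟨⟨?_, h1, h3⟩, h2⟩
      refine nonneg_of_mul_nonneg_right (a := (b : ℝ)) ?_ hb'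
      have := mul_le_mul_of_nonneg_left h2 (add_pos ha' hb').le
      linarith
    · rintro ⟨⟨h1, h2, h3⟩, h4⟩
      exact ⟨h2, h4, h3⟩

/-! ### Triangles in the Euclidean plane -/

theorem affineIndependent_of_dist_lt {P : Fin 3 → Plane}
    (h₀ : dist (P 1) (P 2) < dist (P 0) (P 1) + dist (P 0) (P 2))
    (h₁ : dist (P 0) (P 2) < dist (P 0) (P 1) + dist (P 1) (P 2))
    (h₂ : dist (P 0) (P 1) < dist (P 0) (P 2) + dist (P 1) (P 2)) : AffineIndependent ℝ P := by
  rw [show P = ![P 0, P 1, P 2] by funext i; fin_cases i <;> rfl,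
    affineIndependent_iff_not_collinear_set]
  intro hcol
  rcases hcol.wbtw_or_wbtw_or_wbtw with h | h | h <;> have := h.dist_add_dist <;>
    linarith [dist_comm (P 2) (P 0), dist_comm (P 1) (P 0), dist_comm (P 2) (P 1)]

/-- Since `a, b < c < a + b`, three points at distances proportional to `a`, `b`, `c` satisfy the
strict triangle inequalities. -/
theorem affineIndependent_of_dist_eq {a b c : ℕ} (ha : 0 < a) (hb : 0 < b)
    (hc : c ^ 2 = a ^ 2 + a * b + b ^ 2) {ρ : ℝ} (hρ : 0 < ρ) {P : Fin 3 → Plane}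
    (h₀ : dist (P 1) (P 2) = ρ * a) (h₁ : dist (P 0) (P 2) = ρ * b)
    (h₂ : dist (P 0) (P 1) = ρ * c) : AffineIndependent ℝ P := by
  have ha' : (0 : ℝ) < a := Nat.cast_pos.2 ha
  have hb' : (0 : ℝ) < b := Nat.cast_pos.2 hb
  have hc' : (c : ℝ) ^ 2 = a ^ 2 + a * b + b ^ 2 := by exact_mod_cast hc
  have hc0 : (0 : ℝ) ≤ c := c.cast_nonneg
  have hac : (a : ℝ) < c := lt_of_pow_lt_pow_left₀ 2 hc0 (by rw [hc']; nlinarith)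
  have hbc : (b : ℝ) < c := lt_of_pow_lt_pow_left₀ 2 hc0 (by rw [hc']; nlinarith)
  have hcab : (c : ℝ) < a + b := lt_of_pow_lt_pow_left₀ 2 (by positivity) (by rw [hc']; nlinarith)
  refine affineIndependent_of_dist_lt ?_ ?_ ?_ <;> rw [h₀, h₁, h₂, ← mul_add] <;>
    exact mul_lt_mul_of_pos_left (by linarith) hρ

/-- Coordinates `z ↦ o + z.1 e₁ + z.2 e₂` of the plane, for vectors `e₁`, `e₂` of length `ρ` at
angle `π/3`. -/
theorem exists_coordinates (o e₁ e₂ : Plane) {ρ : ℝ} (hρ : 0 < ρ) (h₁ : ‖e₁‖ = ρ) (h₂ : ‖e₂‖ = ρ)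
    (h₁₂ : inner ℝ e₁ e₂ = ρ ^ 2 / 2) :
    ∃ F : (ℝ × ℝ) ≃ᵃ[ℝ] Plane, (∀ z, F z = o + (z.1 • e₁ + z.2 • e₂)) ∧
      ∀ z w, dist (F z) (F w) ^ 2 = ρ ^ 2 * normForm (z - w) := by
  have hn : ∀ x y : ℝ, ‖x • e₁ + y • e₂‖ ^ 2 = ρ ^ 2 * normForm (x, y) := by
    intro x y
    rw [norm_add_sq_real, norm_smul, norm_smul, inner_smul_left, inner_smul_right, h₁, h₂, h₁₂,
      mul_pow, mul_pow, Real.norm_eq_abs, Real.norm_eq_abs, sq_abs, sq_abs]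
    simp [normForm]
    ring
  let g : (ℝ × ℝ) →ₗ[ℝ] Plane :=
    (LinearMap.toSpanSingleton ℝ Plane e₁).coprod (LinearMap.toSpanSingleton ℝ Plane e₂)
  have hg : ∀ z, g z = z.1 • e₁ + z.2 • e₂ := fun z => by simp [g]
  have hinj : Function.Injective g := by
    rw [← LinearMap.ker_eq_bot, LinearMap.ker_eq_bot']
    intro z hz
    have := hn z.1 z.2
    rw [← hg, hz, norm_zero] at this
    have h0 : normForm (z.1, z.2) = 0 := by
      rcases mul_eq_zero.1 (this.symm.trans (by norm_num)) with h | h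
      · exact absurd h (by positivity)
      · exact h
    simp only [normForm] at h0
    have hz2 : z.2 = 0 := by nlinarith [sq_nonneg (2 * z.1 + z.2), sq_nonneg z.2]
    have hz1 : z.1 = 0 := by rw [hz2] at h0; nlinarith
    exact Prod.ext hz1 hz2
  let e := LinearEquiv.ofInjectiveOfFinrankEq g hinj (by simp)
  have he : ∀ z, e z = g z := fun z => rfl
  refine ⟨e.toAffineEquiv.trans (AffineEquiv.constVAdd ℝ Plane o), fun z => ?_, fun z w => ?_⟩
  · simp [he, hg]
  · simp only [AffineEquiv.trans_apply, LinearEquiv.coe_toAffineEquiv, AffineEquiv.constVAdd_apply,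
      vadd_eq_add, dist_eq_norm, he]
    rw [add_sub_add_left_eq_sub, ← map_sub, hg, hn]

namespace Tri

/-- Dissections in coordinates give tilings of triangles. -/
theorem tilesInto_of_dissect {a b c : ℕ} (ha : 0 < a) (hb : 0 < b)
    (hc : c ^ 2 = a ^ 2 + a * b + b ^ 2) {ρ : ℝ} (hρ : 0 < ρ) (F : (ℝ × ℝ) ≃ᵃ[ℝ] Plane)
    (hF : ∀ z w, dist (F z) (F w) ^ 2 = ρ ^ 2 * normForm (z - w)) {T R : Tri} {S : Set (ℝ × ℝ)}
    {N : ℕ} (h : Dissect (tiles a b) S N) (hT : T.region = F '' S) (h₀ : R.side 0 = ρ * a)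
    (h₁ : R.side 1 = ρ * b) (h₂ : R.side 2 = ρ * c) : T.TilesInto R N := by
  have ha' : (0 : ℝ) < a := Nat.cast_pos.2 ha
  have hb' : (0 : ℝ) < b := Nat.cast_pos.2 hb
  have hc' : (c : ℝ) ^ 2 = a ^ 2 + a * b + b ^ 2 := by exact_mod_cast hc
  have hc0 : (0 : ℝ) ≤ c := c.cast_nonneg
  obtain ⟨Q, hQ, hQS, hQd⟩ := h.image_affineEquiv (𝒯' := {U | ∃ P : Tri,
    Congruent P.points R.points ∧ U = P.region}) F (by
      rintro _ ⟨P, h1, h2, h3, rfl⟩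
      rw [AffineEquiv.image_convexHull_range]
      have d : ∀ i j, ∀ t : ℝ, 0 ≤ t → normForm (P i - P j) = t ^ 2 →
          dist ((F ∘ P) i) ((F ∘ P) j) = ρ * t := by
        intro i j t ht h
        refine (pow_left_inj₀ dist_nonneg (by positivity) two_ne_zero).1 ?_
        rw [Function.comp_apply, Function.comp_apply, hF, h, mul_pow]
      have d12 := d _ _ a ha'.le h1
      have d02 := d _ _ b hb'.le h2
      have d10 := d _ _ c hc0 (h3.trans hc'.symm)
      have d01 := (dist_comm _ _).trans d10
      refine ⟨⟨F ∘ P, affineIndependent_of_dist_eq ha hb hc hρ d12 d02 d01⟩, ?_, rfl⟩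
      · rw [congruent_iff_dist_eq]
        have r12 : dist (R.points 1) (R.points 2) = ρ * a := h₀
        have r20 : dist (R.points 2) (R.points 0) = ρ * b := h₁
        have r01 : dist (R.points 0) (R.points 1) = ρ * c := h₂
        have d21 := (dist_comm _ _).trans d12
        have d20 := (dist_comm _ _).trans d02
        have r21 := (dist_comm _ _).trans r12
        have r02 := (dist_comm _ _).trans r20
        have r10 := (dist_comm _ _).trans r01
        intro i j
        fin_cases i <;> fin_cases j
        · simp
        · exact d01.trans r01.symm
        · exact d02.trans r02.symm
        · exact d10.trans r10.symm
        · simp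
        · exact d12.trans r12.symm
        · exact d20.trans r20.symm
        · exact d21.trans r21.symm
        · simp)
  choose P hP hPQ using hQ
  refine ⟨P, hP, ?_, ?_⟩
  · rw [hT, ← hQS]
    exact Set.iUnion_congr fun i => (hPQ i).symm
  · intro i j hij
    rw [← hPQ, ← hPQ]
    exact hQd i j hij

open EuclideanGeometry in
/-- The tiling of the triangle with vertices `V`, `W`, `C`, where the angle at `C` is `π/3` and the
sides at `C` are in the ratio `a + b : a`. -/
theorem exists_tile {T : Tri} {V W C : Plane} (hT : T.region = convexHull ℝ (Set.range ![W, V, C]))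
    (hWC : 0 < dist W C) (hC : ∠ V C W = Real.pi / 3) {a b c m : ℕ} (ha : 0 < a) (hb : 0 < b)
    (hc0 : 0 < c) (hc : c ^ 2 = a ^ 2 + a * b + b ^ 2) (hm : 3 * (a + b + 2) ≤ m)
    (hd : dist V C * a = dist W C * (a + b)) :
    ∃ R : Tri, R.angleAt 0 = ∠ W V C ∧ R.angleAt 1 = ∠ C W V - Real.pi / 3 ∧
      R.angleAt 2 = 2 * Real.pi / 3 ∧
      (∃ r : ℝ, 0 < r ∧ R.side 0 = r * a ∧ R.side 1 = r * b ∧ R.side 2 = r * c) ∧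
      T.TilesInto R (m ^ 2 * (b * (a + b))) := by
  have ha' : (0 : ℝ) < a := Nat.cast_pos.2 ha
  have hb' : (0 : ℝ) < b := Nat.cast_pos.2 hb
  have hm' : (0 : ℝ) < m := Nat.cast_pos.2 (by omega)
  have hc0' : (0 : ℝ) < c := Nat.cast_pos.2 hc0
  have hc' : (c : ℝ) ^ 2 = a ^ 2 + a * b + b ^ 2 := by exact_mod_cast hc
  -- the unit of length, for which the tile has the sides `a`, `b`, `c`
  obtain ⟨ρ, hρ, hWρ⟩ : ∃ ρ : ℝ, 0 < ρ ∧ dist W C = ρ * (m * (a * b)) :=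
    ⟨dist W C / (m * (a * b)), by positivity, by field_simp⟩
  have hVρ : dist V C = ρ * (m * (b * (a + b))) := by
    apply mul_right_cancel₀ ha'.ne'
    rw [hd, hWρ]; ring
  have hp : (0 : ℝ) < m * (b * (a + b)) := by positivity
  have hq : (0 : ℝ) < m * (a * b) := by positivity
  set p : ℝ := m * (b * (a + b)) with hpdef
  set q : ℝ := m * (a * b) with hqdef
  have hVn : ‖V - C‖ = ρ * p := by rw [← dist_eq_norm, hVρ]
  have hWn : ‖W - C‖ = ρ * q := by rw [← dist_eq_norm, hWρ]
  obtain ⟨F, hF, hFd⟩ := exists_coordinates C (p⁻¹ • (V - C)) (q⁻¹ • (W - C)) hρ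
    (by rw [norm_smul, hVn, Real.norm_of_nonneg (by positivity)]; field_simp)
    (by rw [norm_smul, hWn, Real.norm_of_nonneg (by positivity)]; field_simp)
    (by
      have h1 : inner ℝ (V - C) (W - C) = ‖V - C‖ * ‖W - C‖ * Real.cos (∠ V C W) := by
        rw [EuclideanGeometry.angle, vsub_eq_sub, vsub_eq_sub, mul_comm,
          InnerProductGeometry.cos_angle_mul_norm_mul_norm]
      rw [inner_smul_left, inner_smul_right, h1, hVn, hWn, hC, Real.cos_pi_div_three]
      simp only [conj_trivial]
      field_simp)
  have hFV : F (p, 0) = V := by rw [hF]; simp [smul_smul, hp.ne']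
  have hFW : F (0, q) = W := by rw [hF]; simp [smul_smul, hq.ne']
  have hFC : F 0 = C := by rw [hF]; simp
  have hpq : ((p, 0) : ℝ × ℝ).1 * ((0, q) : ℝ × ℝ).2 -
      ((p, 0) : ℝ × ℝ).2 * ((0, q) : ℝ × ℝ).1 ≠ 0 := by
    simp [hp.ne', hq.ne']
  have hregion : T.region = F '' {z | 0 ≤ z.1 ∧ 0 ≤ z.2 ∧
      (a : ℝ) * z.1 + (a + b) * z.2 ≤ m * (a * b * (a + b))} := by
    have e1 : (![W, V, C] : Fin 3 → Plane) = F ∘ (frameEquiv 0 (p, 0) (0, q) hpq ∘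
        ![((0 : ℝ), (1 : ℝ)), (1, 0), (0, 0)]) := by
      funext i
      fin_cases i
      · simp [frameEquiv_apply, hFW]
      · simp [frameEquiv_apply, hFV]
      · simp [frameEquiv_apply, hFC]
    rw [hT, e1, ← AffineEquiv.image_convexHull_range, ← AffineEquiv.image_convexHull_range,
      convexHull_range_corner, AffineEquiv.image_eq_setOf (frameEquiv 0 (p, 0) (0, q) hpq)
      (fun z => (z.1 / p, z.2 / q)) (by intro z; ext <;> simp [frameEquiv_apply, hp.ne', hq.ne'])]
    congr 1
    ext z
    have e2 : (m : ℝ) * (a * b * (a + b)) = p * a := by rw [hpdef]; ring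
    have e3 : z.1 / p + z.2 / q = (a * z.1 + (a + b) * z.2) / (p * a) := by
      rw [hpdef, hqdef]; field_simp
    simp only [corner, Set.mem_ofPred_eq, sub_zero]
    rw [e2, e3, div_le_one (by positivity), le_div_iff₀ hp, le_div_iff₀ hq, zero_mul, zero_mul]
  -- the tile at the vertex `V`
  have hd2 : ∀ z w : ℝ × ℝ, ∀ t : ℝ, 0 ≤ t → normForm (z - w) = t ^ 2 →
      dist (F z) (F w) = ρ * t := by
    intro z w t ht h
    refine (pow_left_inj₀ dist_nonneg (by positivity) two_ne_zero).1 ?_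
    rw [hFd, h, mul_pow]
  obtain ⟨e₁, e₂, hF'⟩ : ∃ e₁ e₂ : Plane, ∀ z, F z = C + (z.1 • e₁ + z.2 • e₂) := ⟨_, _, hF⟩
  set R₁ := F (p - (a + b), a) with hR₁
  set R₂ := F (p - b, 0) with hR₂
  have d12 : dist R₁ R₂ = ρ * a := hd2 _ _ _ ha'.le (by simp [normForm]; ring)
  have d02 : dist V R₂ = ρ * b := by
    rw [← hFV]; exact hd2 _ _ _ hb'.le (by simp [normForm])
  have d01 : dist V R₁ = ρ * c := by
    rw [← hFV]; exact hd2 _ _ _ hc0'.le (by simp [normForm]; rw [hc']; ring)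
  have hang0 : ∠ R₁ V R₂ = ∠ W V C := by
    have v1 : W -ᵥ V = ((m : ℝ) * b) • (R₁ -ᵥ V) := by
      rw [hR₁, ← hFV, ← hFW, vsub_eq_sub, vsub_eq_sub, hF', hF', hF', hpdef, hqdef]
      module
    have v2 : C -ᵥ V = ((m : ℝ) * (a + b)) • (R₂ -ᵥ V) := by
      rw [hR₂, ← hFV, vsub_eq_sub, vsub_eq_sub, hF', hF', hpdef]
      module
    rw [EuclideanGeometry.angle, EuclideanGeometry.angle, v1, v2,
      InnerProductGeometry.angle_smul_left_of_pos _ _ (by positivity),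
      InnerProductGeometry.angle_smul_right_of_pos _ _ (by positivity)]
  have hang2 : ∠ V R₂ R₁ = 2 * Real.pi / 3 := by
    have h := law_cos V R₂ R₁
    rw [d01, d02, d12] at h
    have hcos : Real.cos (∠ V R₂ R₁) = Real.cos (2 * Real.pi / 3) := by
      have e : Real.cos (2 * Real.pi / 3) = -(1 / 2) := by
        rw [show 2 * Real.pi / 3 = Real.pi - Real.pi / 3 by ring, Real.cos_pi_sub,
          Real.cos_pi_div_three]
      rw [e]
      have h0 : (ρ ^ 2 * (2 * a * b)) * (Real.cos (∠ V R₂ R₁) + 1 / 2) = 0 := by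
        linear_combination h - ρ ^ 2 * hc'
      rcases mul_eq_zero.1 h0 with h1 | h1
      · exact absurd h1 (by positivity)
      · linarith
    exact Real.injOn_cos ⟨angle_nonneg _ _ _, angle_le_pi _ _ _⟩
      ⟨by positivity, by linarith [Real.pi_pos]⟩ hcos
  have hVW : V ≠ C := by
    rw [← dist_pos, hVρ]; positivity
  have hVR : R₂ ≠ V := by
    rw [← dist_pos, dist_comm, d02]; positivity
  have hang1 : ∠ R₂ R₁ V = ∠ C W V - Real.pi / 3 := by
    have s1 := angle_add_angle_add_angle_eq_pi W hVW.symm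
    have s2 := angle_add_angle_add_angle_eq_pi R₁ hVR
    linarith
  refine ⟨⟨![V, R₁, R₂], affineIndependent_of_dist_eq ha hb hc hρ d12 d02 d01⟩, hang0, hang1,
    hang2, ⟨ρ, hρ, d12, (dist_comm _ _).trans d02, d01⟩, ?_⟩
  exact tilesInto_of_dissect ha hb hc hρ F hFd (dissect_triangle ha hb hc0 hc hm) hregion
    d12 ((dist_comm _ _).trans d02) d01

open EuclideanGeometry Real in
/-- The law of sines makes the sides commensurable: with `q = √3 tan (A / 2)`, the sides at the
vertex of the angle `π/3` are to the opposite side as `(3 - q² + 2 q) / (3 + q²)` and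
`4 q / (3 + q²)`. -/
theorem exists_nat_sides {A B C : Plane} (hAB : A ≠ B) (hAC : A ≠ C)
    (hC : ∠ A C B = π / 3) {q : ℚ} (hq : √3 * tan (∠ B A C / 2) = q) :
    ∃ (s : ℝ) (X Y Z : ℕ), 0 < s ∧ dist A C = s * X ∧ dist B C = s * Y ∧ dist A B = s * Z := by
  set α := ∠ B A C with hα
  have h3 : √3 * √3 = 3 := Real.mul_self_sqrt (by norm_num)
  have hsum := angle_add_angle_add_angle_eq_pi B hAC.symm
  have hαlt : α < π := by
    have := angle_nonneg C B A
    have := Real.pi_pos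
    linarith
  have hcos : cos (α / 2) ≠ 0 := by
    refine (Real.cos_pos_of_mem_Ioo ⟨?_, ?_⟩).ne'
    · linarith [angle_nonneg B A C, Real.pi_pos]
    · linarith
  have hsc : √3 * sin (α / 2) = q * cos (α / 2) := by
    rw [← hq, Real.tan_eq_sin_div_cos]; field_simp
  have hs1 := Real.sin_sq_add_cos_sq (α / 2)
  have hcc : (3 + (q : ℝ) ^ 2) * cos (α / 2) ^ 2 = 3 := by
    linear_combination 3 * hs1 - (√3 * sin (α / 2) + q * cos (α / 2)) * hsc +
      sin (α / 2) ^ 2 * h3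
  have hsinα : (3 + (q : ℝ) ^ 2) * (√3 * sin α) = 6 * q := by
    rw [show α = 2 * (α / 2) by ring, Real.sin_two_mul]
    linear_combination (3 + (q : ℝ) ^ 2) * 2 * cos (α / 2) * hsc + 2 * q * hcc
  have hcosα : (3 + (q : ℝ) ^ 2) * cos α = 3 - q ^ 2 := by
    rw [show α = 2 * (α / 2) by ring, Real.cos_two_mul]
    linear_combination 2 * hcc
  have hβ : sin (∠ C B A) = 1 / 2 * sin α + √3 / 2 * cos α := by
    rw [show ∠ C B A = π - (π / 3 + α) by linarith, Real.sin_pi_sub,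
      Real.sin_add, Real.sin_pi_div_three, Real.cos_pi_div_three]
    ring
  have hz0 : 0 < dist A B := dist_pos.2 hAB
  have hy : (3 + (q : ℝ) ^ 2) * dist B C = 4 * q * dist A B := by
    have h := law_sin A C B
    rw [hC, Real.sin_pi_div_three, dist_comm C B, dist_comm B A] at h
    linear_combination (3 + (q : ℝ) ^ 2) * (2 / 3) * √3 * h + 2 / 3 * dist A B * hsinα -
      (3 + (q : ℝ) ^ 2) / 3 * dist B C * h3
  have hx : (3 + (q : ℝ) ^ 2) * dist A C = (3 - q ^ 2 + 2 * q) * dist A B := by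
    have h := law_sin C B A
    rw [hC, hβ, Real.sin_pi_div_three, dist_comm B A] at h
    linear_combination -(3 + (q : ℝ) ^ 2) * (2 / 3) * √3 * h + 1 / 3 * dist A B * hsinα +
      dist A B * hcosα - (3 + (q : ℝ) ^ 2) / 3 * (dist A C - dist A B * cos α) * h3
  have hq3 : (0 : ℝ) < 3 + (q : ℝ) ^ 2 := by positivity
  have hfrac : ∀ (t : ℝ) (r : ℚ), 0 ≤ t → t = r * dist A B →
      ∃ n d : ℕ, 0 < d ∧ t * d = n * dist A B := by
    intro t r ht hr
    have hr0 : 0 ≤ r := by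
      have : (0 : ℝ) ≤ r := nonneg_of_mul_nonneg_left (hr ▸ ht) hz0
      exact_mod_cast this
    refine ⟨r.num.toNat, r.den, r.den_pos, ?_⟩
    have hn : ((r.num.toNat : ℤ) : ℝ) = r.num := by
      rw [Int.toNat_of_nonneg (Rat.num_nonneg.2 hr0)]
    have hd : (r.den : ℝ) ≠ 0 := Nat.cast_ne_zero.2 r.den_ne_zero
    rw [Int.cast_natCast] at hn
    rw [hr, hn, Rat.cast_def r]
    field_simp
  obtain ⟨n₁, d₁, hd₁, e₁⟩ := hfrac (dist B C) (4 * q / (3 + q ^ 2)) dist_nonneg (by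
    push_cast
    field_simp
    linarith)
  obtain ⟨n₂, d₂, hd₂, e₂⟩ := hfrac (dist A C) ((3 - q ^ 2 + 2 * q) / (3 + q ^ 2)) dist_nonneg (by
    push_cast
    field_simp
    linarith)
  have hd₁' : (0 : ℝ) < d₁ := Nat.cast_pos.2 hd₁
  have hd₂' : (0 : ℝ) < d₂ := Nat.cast_pos.2 hd₂
  refine ⟨dist A B / (d₁ * d₂), n₂ * d₁, n₁ * d₂, d₁ * d₂, by positivity, ?_, ?_, ?_⟩
  · push_cast
    field_simp
    linarith
  · push_cast
    field_simp
    linarith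
  · push_cast
    field_simp

open EuclideanGeometry in
/-- The side lengths determine `a`, `b`, `c`; incommensurability of the angles enters only to
exclude the equilateral triangle. -/
theorem exists_tiles_of_incommensurableAngles (T : Tri) (hT : T.IncommensurableAngles)
    (hC : T.angleAt 2 = Real.pi / 3)
    (hA : ∃ q : ℚ, Real.sqrt 3 * Real.tan (T.angleAt 0 / 2) = (q : ℝ)) :
    ∃ a b c : ℕ, 0 < a ∧ 0 < b ∧ 0 < c ∧ Nat.Coprime a b ∧ c ^ 2 = a ^ 2 + a * b + b ^ 2 ∧
      ∃ m₀ : ℕ, 0 < m₀ ∧ ∀ m : ℕ, m₀ ≤ m →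
        ¬ IsSquare (m ^ 2 * (b * (a + b))) ∧
        ∃ R : Tri,
          R.angleAt 0 = min (T.angleAt 0) (T.angleAt 1) ∧
          R.angleAt 1 = max (T.angleAt 0) (T.angleAt 1) - Real.pi / 3 ∧
          R.angleAt 2 = 2 * Real.pi / 3 ∧
          (∃ r : ℝ, 0 < r ∧ R.side 0 = r * a ∧ R.side 1 = r * b ∧ R.side 2 = r * c) ∧
          T.TilesInto R (m ^ 2 * (b * (a + b))) := by
  obtain ⟨q, hq⟩ := hA
  set A := T.points 0
  set B := T.points 1
  set C := T.points 2
  have hne : ∀ i j, i ≠ j → T.points i ≠ T.points j := fun i j h => T.independent.injective.ne h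
  have hAB : A ≠ B := hne 0 1 (by decide)
  have hBC : B ≠ C := hne 1 2 (by decide)
  have hAC : A ≠ C := hne 0 2 (by decide)
  have hα : T.angleAt 0 = ∠ B A C := rfl
  have hβ : T.angleAt 1 = ∠ C B A := rfl
  have hγ : ∠ A C B = Real.pi / 3 := hC
  have hsum := angle_add_angle_add_angle_eq_pi B hAC.symm
  obtain ⟨s, X, Y, Z, hs, hX, hY, hZ⟩ := exists_nat_sides hAB hAC hγ hq
  have hX0 : 0 < X := Nat.pos_of_ne_zero (by
    rintro rfl; exact hAC (dist_eq_zero.1 (by rw [hX]; simp)))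
  have hY0 : 0 < Y := Nat.pos_of_ne_zero (by
    rintro rfl; exact hBC (dist_eq_zero.1 (by rw [hY]; simp)))
  have hrel : Z ^ 2 + X * Y = X ^ 2 + Y ^ 2 := by
    have h := law_cos A C B
    rw [hX, hY, hZ, hγ, Real.cos_pi_div_three] at h
    have h' : s ^ 2 * ((Z : ℝ) ^ 2 + X * Y) = s ^ 2 * (X ^ 2 + Y ^ 2) := by linear_combination h
    have := mul_left_cancel₀ (pow_ne_zero 2 hs.ne') h'
    exact_mod_cast this
  -- the vertex `V` of the smaller angle lies opposite to the shorter of the sides `X`, `Y` at `C`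
  rcases lt_trichotomy X Y with hXY | hXY | hXY
  · obtain ⟨a, b, c, ha, hb, hc0, hab, hc, hr⟩ :=
      exists_coprime_params hX0 hXY (by linarith [mul_comm X Y])
    refine ⟨a, b, c, ha, hb, hc0, hab, hc, 3 * (a + b + 2), by positivity, fun m hm =>
      ⟨not_isSquare_sq_mul (by omega) (not_isSquare_mul_add ha hb hab hc), ?_⟩⟩
    have hr' : (Y : ℝ) * a = X * (a + b) := by exact_mod_cast hr
    obtain ⟨R, h0, h1, h2, h3, h4⟩ := exists_tile (T := T) (V := B) (W := A) (C := C)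
      (by
        rw [Tri.region]
        congr 2
        funext i
        fin_cases i <;> rfl)
      (dist_pos.2 hAC) (by rw [angle_comm]; exact hγ) ha hb hc0 hc hm
      (by rw [hX, hY]; linear_combination s * hr')
    refine ⟨R, ?_, ?_, h2, h3, h4⟩
    all_goals
      have h5 : 0 ≤ R.angleAt 1 := angle_nonneg _ _ _
      rw [angle_comm C A B] at h1
      rw [angle_comm A B C] at h0
      have h6 : ∠ C B A ≤ ∠ B A C := by linarith
    · rw [h0, hα, hβ, min_eq_right h6]
    · rw [h1, hα, hβ, max_eq_left h6]
  · exfalso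
    have hiso : dist C A = dist C B := by
      rw [dist_comm, hX, dist_comm C B, hY, hXY]
    have h := angle_eq_angle_of_dist_eq hiso
    rw [angle_comm C A B] at h
    apply hT
    intro i
    refine ⟨1 / 3, ?_⟩
    push_cast
    fin_cases i
    · change ∠ B A C = _
      linarith
    · change ∠ C B A = _
      linarith
    · change ∠ A C B = _
      linarith
  · obtain ⟨a, b, c, ha, hb, hc0, hab, hc, hr⟩ :=
      exists_coprime_params hY0 hXY hrel
    refine ⟨a, b, c, ha, hb, hc0, hab, hc, 3 * (a + b + 2), by positivity, fun m hm =>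
      ⟨not_isSquare_sq_mul (by omega) (not_isSquare_mul_add ha hb hab hc), ?_⟩⟩
    have hr' : (X : ℝ) * a = Y * (a + b) := by exact_mod_cast hr
    obtain ⟨R, h0, h1, h2, h3, h4⟩ := exists_tile (T := T) (V := A) (W := B) (C := C)
      (by
        rw [Tri.region]
        congr 1
        ext z
        constructor
        · rintro ⟨i, rfl⟩
          fin_cases i
          · exact ⟨1, rfl⟩
          · exact ⟨0, rfl⟩
          · exact ⟨2, rfl⟩
        · rintro ⟨i, rfl⟩
          fin_cases i
          · exact ⟨1, rfl⟩
          · exact ⟨0, rfl⟩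
          · exact ⟨2, rfl⟩)
      (dist_pos.2 hBC) hγ ha hb hc0 hc hm
      (by rw [hX, hY]; linear_combination s * hr')
    refine ⟨R, ?_, ?_, h2, h3, h4⟩
    all_goals
      have h5 : 0 ≤ R.angleAt 1 := angle_nonneg _ _ _
      have h6 : ∠ B A C ≤ ∠ C B A := by linarith
    · rw [h0, hα, hβ, min_eq_left h6]
    · rw [h1, hα, hβ, max_eq_right h6]

end Tri

/-- Write `A`, `B`, `π/3` for the angles of `T` at its vertices `0`, `1`, `2`. -/
theorem mainTheorem4 (T : Tri) (hT : T.IncommensurableAngles)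
    (hC : T.angleAt 2 = Real.pi / 3)
    (hA : ∃ q : ℚ, Real.sqrt 3 * Real.tan (T.angleAt 0 / 2) = (q : ℝ)) :
    T.HasNonSquareTiling ∧
    ∃ a b c : ℕ, 0 < a ∧ 0 < b ∧ 0 < c ∧ Nat.Coprime a b ∧ c ^ 2 = a ^ 2 + a * b + b ^ 2 ∧
      ∃ m₀ : ℕ, 0 < m₀ ∧ ∀ m : ℕ, m₀ ≤ m →
        ¬ IsSquare (m ^ 2 * (b * (a + b))) ∧
        ∃ R : Tri,
          R.angleAt 0 = min (T.angleAt 0) (T.angleAt 1) ∧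
          R.angleAt 1 = max (T.angleAt 0) (T.angleAt 1) - Real.pi / 3 ∧
          R.angleAt 2 = 2 * Real.pi / 3 ∧
          (∃ r : ℝ, 0 < r ∧ R.side 0 = r * a ∧ R.side 1 = r * b ∧ R.side 2 = r * c) ∧
          T.TilesInto R (m ^ 2 * (b * (a + b))) := by
  have h := T.exists_tiles_of_incommensurableAngles hT hC hA
  refine ⟨?_, h⟩
  obtain ⟨a, b, c, -, -, -, -, -, m₀, -, hm⟩ := h
  obtain ⟨hsq, R, -, -, -, -, hR⟩ := hm m₀ le_rfl
  exact ⟨R, _, hR, hsq⟩
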